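/- Let $k$ be a field, $n\ge 0$ an integer, $S=k[x_1,\dots,x_{2n}]$, and let $\mathcal P$ be a pairing of the $2n$ variables: a bijection that assigns to each direction $i\in\{1,\dots,n\}$ an ordered pair of variables $(y_{i},z_{i})$, so that every variable occurs exactly once. Let $I_{\mathcal P}\subset S$ be the cube ideal, generated by the $2^n$ products $\prod_{i=1}^n w_i$ with $w_i\in\{y_i,z_i\}$. For $p\ge 1$ let $C_n^p$ be the labelled regular CW complex obtained from the cube $[0,p]^n$ by cutting it into unit cubes, where the vertex $a\in\{0,\dots,p\}^n$ has the label $\prod_{i} y_i^{\,p-a_i}z_i^{\,a_i}$ and every other cell has the least common multiple of the labels of its vertices (the empty face has the label $1$). The cellular complex of $C_n^p$ has as its $t$-th module the free $S$-module $F_t$ on the faces of dimension $t-1$, with the differential $\partial F=\sum_{G}\operatorname{sign}(G,F)\,x^{a_F-a_G}\,G$, the sum over the faces $G$ of codimension one in $F$, where $x^{a_F}$ is the label of $F$. Let $\mathcal F_C$ be the category whose objects are the $C_n^p$, $p\ge 1$, with their cellular complexes, and whose morphisms $C_n^p\to C_n^q$ are the pairs $(f,g)$ of a chain map $f$ of the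 cellular complexes and a cellular map $g$ taking $d$-cells onto $d$-cells for all $d$, which are compatible (if $g$ maps the cell $x$ onto the cell $y$, then $f_0\colon S\to S$ maps the label of $x$ to the label of $y$, and $f$ maps the basis element of $x$ to a nonzero multiple of that of $y$), such that $f_0$ is the multiplication by a monomial; to have one morphism for each chain map, $g$ is taken to be the restriction of a translation of $\mathbb R^n$. For $t\ge 0$ let $\sigma_t\colon\mathcal F_C\to\mathrm{Mod}_S$ be the $t$-th syzygy functor, which takes $C_n^p$ to the $t$-th syzygy module $\operatorname{im}(F_{t+1}\to F_t)$ and a morphism to the restriction of its chain map. Then: 1. For every $p\ge 1$ the complex $C_n^p$ supports a resolution of $S/I_{\mathcal P}^p$: its cellular complex is exact in all positive degrees, and the image of $F_1\to F_0=S$ is $I_{\mathcal P}^p$. 2. For every $p\ge 2$ the complex $C_n^1$ covers $C_n^p$: $\operatorname{Hom}(C_n^1,C_n^p)$ is not empty, and the union of the images $g(C_n^1)$ over all $(f,g)\in \operatorname{Hom}(C_n^1,C_n^p)$ is $C_n^p$. 3. $\mathcal F_C$ has finitely generated syzygies: for every $t\ge 0$ the representation $\sigma_t$ is finitely generated, i.e.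 there is a finite set of elements of the modules $\sigma_t(C_n^p)$ that is contained in no proper subrepresentation of $\sigma_t$. -/

import Mathlib

open Metric Set

/-! ### The cells of a subdivided cube -/

/-- A `d`-dimensional cell of the cube `[0, p]^n` cut by all the hyperplanes `zᵢ = j`, `j` an
integer: a lower corner `c.1.1` and the set `c.1.2` of the `d` directions in which it extends by
one unit. -/
def CubeCell (n p d : ℕ) : Type :=
  {c : (Fin n → Fin (p + 1)) × Finset (Fin n) // c.2.card = d ∧ ∀ i ∈ c.2, (c.1 i : ℕ) < p}

namespace CubeCell

variable {n p d : ℕ}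

instance : Fintype (CubeCell n p d) :=
  inferInstanceAs (Fintype
    {c : (Fin n → Fin (p + 1)) × Finset (Fin n) // c.2.card = d ∧ ∀ i ∈ c.2, (c.1 i : ℕ) < p})

/-- The lower corner of a cell. -/
def base (c : CubeCell n p d) : Fin n → ℕ := fun i => (c.1.1 i : ℕ)

/-- The directions of a cell. -/
def dirs (c : CubeCell n p d) : Finset (Fin n) := c.1.2

theorem card_dirs (c : CubeCell n p d) : c.dirs.card = d := c.2.1

theorem base_le (c : CubeCell n p d) (i : Fin n) : c.base i ≤ p := Nat.lt_succ_iff.1 (c.1.1 i).2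

theorem base_lt (c : CubeCell n p d) {i : Fin n} (hi : i ∈ c.dirs) : c.base i < p := c.2.2 i hi

/-- The cell with a given lower corner and given directions. -/
def mk (a : Fin n → ℕ) (D : Finset (Fin n)) (ha : ∀ i, a i ≤ p) (hD : D.card = d)
    (h : ∀ i ∈ D, a i < p) : CubeCell n p d :=
  ⟨(fun i => ⟨a i, Nat.lt_succ_iff.2 (ha i)⟩, D), hD, h⟩

@[simp] theorem base_mk (a : Fin n → ℕ) (D : Finset (Fin n)) (ha : ∀ i, a i ≤ p)
    (hD : D.card = d) (h : ∀ i ∈ D, a i < p) : (mk a D ha hD h).base = a := rfl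

@[simp] theorem dirs_mk (a : Fin n → ℕ) (D : Finset (Fin n)) (ha : ∀ i, a i ≤ p)
    (hD : D.card = d) (h : ∀ i ∈ D, a i < p) : (mk a D ha hD h).dirs = D := rfl

theorem ext' {c e : CubeCell n p d} (h : c.base = e.base) (h' : c.dirs = e.dirs) : c = e := by
  apply Subtype.ext
  apply Prod.ext
  · funext i
    exact Fin.ext (congrFun h i)
  · exact h'

/-- The lowest point of a cell. -/
def lo (c : CubeCell n p d) : Fin n → ℝ := fun i => (c.base i : ℝ)

/-- The highest point of a cell. -/
def hi (c : CubeCell n p d) : Fin n → ℝ := fun i => (c.base i : ℝ) + if i ∈ c.dirs then 1 else 0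

theorem lo_le_hi (c : CubeCell n p d) : c.lo ≤ c.hi := by
  intro i
  simp only [lo, hi]
  split_ifs <;> simp

/-- The affine characteristic map `[-1, 1]^d → [0, p]^n` of a cell. -/
noncomputable def charFun (c : CubeCell n p d) (u : Fin d → ℝ) : Fin n → ℝ := fun i =>
  if h : i ∈ c.dirs then
    (c.base i : ℝ) + (1 + u ((c.dirs.orderIsoOfFin c.card_dirs).symm ⟨i, h⟩)) / 2
  else (c.base i : ℝ)

/-- The affine left inverse of the characteristic map. -/
noncomputable def charInv (c : CubeCell n p d) (z : Fin n → ℝ) : Fin d → ℝ := fun j =>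
  2 * (z (c.dirs.orderIsoOfFin c.card_dirs j) - c.base (c.dirs.orderIsoOfFin c.card_dirs j)) - 1

theorem charInv_charFun (c : CubeCell n p d) (u : Fin d → ℝ) : c.charInv (c.charFun u) = u := by
  funext j
  have h : ((c.dirs.orderIsoOfFin c.card_dirs j : c.dirs) : Fin n) ∈ c.dirs :=
    (c.dirs.orderIsoOfFin c.card_dirs j).2
  simp only [charInv, charFun, h, dite_true, Subtype.coe_eta, OrderIso.symm_apply_apply]
  ring

theorem charFun_injective (c : CubeCell n p d) : Function.Injective c.charFun :=
  Function.LeftInverse.injective c.charInv_charFun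

theorem charFun_charInv (c : CubeCell n p d) {z : Fin n → ℝ}
    (hz : ∀ i ∉ c.dirs, z i = c.base i) : c.charFun (c.charInv z) = z := by
  funext i
  by_cases h : i ∈ c.dirs
  · simp only [charInv, charFun, h, dite_true, OrderIso.apply_symm_apply]
    ring
  · simp only [charFun, h, dite_false, hz i h]

theorem continuous_charFun (c : CubeCell n p d) : Continuous c.charFun := by
  refine continuous_pi fun i => ?_
  unfold charFun
  split_ifs <;> fun_prop

theorem continuous_charInv (c : CubeCell n p d) : Continuous c.charInv := by
  refine continuous_pi fun i => ?_
  unfold charInv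
  fun_prop

/-- The characteristic map of a cell as a partial equivalence. -/
noncomputable def charMap (c : CubeCell n p d) : PartialEquiv (Fin d → ℝ) (Fin n → ℝ) where
  toFun := c.charFun
  invFun := c.charInv
  source := ball 0 1
  target := c.charFun '' ball 0 1
  map_source' _ h := mem_image_of_mem _ h
  map_target' := by
    rintro _ ⟨u, hu, rfl⟩
    rwa [charInv_charFun]
  left_inv' u _ := c.charInv_charFun u
  right_inv' := by
    rintro _ ⟨u, _, rfl⟩
    rw [charInv_charFun]

theorem charFun_image_closedBall (c : CubeCell n p d) :
    c.charFun '' closedBall 0 1 = Icc c.lo c.hi := by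
  apply Subset.antisymm
  · rintro _ ⟨u, hu, rfl⟩
    rw [mem_closedBall_zero_iff, pi_norm_le_iff_of_nonneg zero_le_one] at hu
    refine ⟨fun i => ?_, fun i => ?_⟩ <;> by_cases h : i ∈ c.dirs <;>
      simp only [lo, hi, charFun, h, dite_true, dite_false, if_true, if_false] <;>
      try linarith
    all_goals
      have := abs_le.1 (hu ((c.dirs.orderIsoOfFin c.card_dirs).symm ⟨i, h⟩))
      linarith [this.1, this.2]
  · rintro z ⟨h1, h2⟩
    refine ⟨c.charInv z, ?_, c.charFun_charInv fun i hi' => ?_⟩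
    · rw [mem_closedBall_zero_iff, pi_norm_le_iff_of_nonneg zero_le_one]
      intro j
      have h : ((c.dirs.orderIsoOfFin c.card_dirs j : c.dirs) : Fin n) ∈ c.dirs :=
        (c.dirs.orderIsoOfFin c.card_dirs j).2
      have h1 := h1 (c.dirs.orderIsoOfFin c.card_dirs j)
      have h2 := h2 (c.dirs.orderIsoOfFin c.card_dirs j)
      simp only [lo, hi, h, if_true] at h1 h2
      rw [Real.norm_eq_abs, abs_le]
      simp only [charInv]
      constructor <;> linarith
    · have h1 := h1 i
      have h2 := h2 i
      simp only [lo, hi, hi', if_false] at h1 h2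
      linarith

theorem mem_charFun_image_ball (c : CubeCell n p d) {z : Fin n → ℝ}
    (hz : z ∈ c.charFun '' ball 0 1) (i : Fin n) :
    (i ∈ c.dirs → (c.base i : ℝ) < z i ∧ z i < c.base i + 1) ∧
      (i ∉ c.dirs → z i = c.base i) := by
  obtain ⟨u, hu, rfl⟩ := hz
  rw [mem_ball_zero_iff, pi_norm_lt_iff one_pos] at hu
  refine ⟨fun h => ?_, fun h => ?_⟩ <;> simp only [charFun, h, dite_true, dite_false]
  have := abs_lt.1 (hu ((c.dirs.orderIsoOfFin c.card_dirs).symm ⟨i, h⟩))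
  constructor <;> linarith [this.1, this.2]

theorem eq_of_mem_ball {e : ℕ} (c : CubeCell n p d) (c' : CubeCell n p e) {z : Fin n → ℝ}
    (hz : z ∈ c.charFun '' ball 0 1) (hz' : z ∈ c'.charFun '' ball 0 1) :
    c.base = c'.base ∧ c.dirs = c'.dirs := by
  have key : ∀ i, c.base i = c'.base i ∧ (i ∈ c.dirs ↔ i ∈ c'.dirs) := by
    intro i
    obtain ⟨h1, h2⟩ := c.mem_charFun_image_ball hz i
    obtain ⟨h1', h2'⟩ := c'.mem_charFun_image_ball hz' i
    by_cases h : i ∈ c.dirs <;> by_cases h' : i ∈ c'.dirs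
    · obtain ⟨a, b⟩ := h1 h
      obtain ⟨a', b'⟩ := h1' h'
      refine ⟨?_, by simp [h, h']⟩
      have x : c.base i < c'.base i + 1 := by exact_mod_cast a.trans b'
      have y : c'.base i < c.base i + 1 := by exact_mod_cast a'.trans b
      omega
    · exfalso
      obtain ⟨a, b⟩ := h1 h
      rw [h2' h'] at a b
      have x : c.base i < c'.base i := by exact_mod_cast a
      have y : c'.base i < c.base i + 1 := by exact_mod_cast b
      omega
    · exfalso
      obtain ⟨a, b⟩ := h1' h'
      rw [h2 h] at a b
      have x : c'.base i < c.base i := by exact_mod_cast a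
      have y : c.base i < c'.base i + 1 := by exact_mod_cast b
      omega
    · have := (h2 h).symm.trans (h2' h')
      exact ⟨by exact_mod_cast this, by simp [h, h']⟩
  exact ⟨funext fun i => (key i).1, Finset.ext fun i => (key i).2⟩

/-- The facet of a cell in direction `i`, at the lower (`ε = 0`) or upper (`ε = 1`) end. -/
def facet (c : CubeCell n p (d + 1)) (i : Fin n) (hi : i ∈ c.dirs) (ε : ℕ) (hε : ε ≤ 1) :
    CubeCell n p d :=
  mk (c.base + Pi.single i ε) (c.dirs.erase i)
    (fun j => by
      by_cases h : j = i
      · subst h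
        have := c.base_lt hi
        simp only [Pi.add_apply, Pi.single_eq_same]
        omega
      · simpa [h] using c.base_le j)
    (by rw [Finset.card_erase_of_mem hi, c.card_dirs]; rfl)
    (fun j hj => by
      have h : j ≠ i := Finset.ne_of_mem_erase hj
      simpa [h] using c.base_lt (Finset.mem_of_mem_erase hj))

/-- `G` is the facet of `F` in direction `i`, at the lower (`ε = 0`) or upper (`ε = 1`) end. -/
def IsFacet (F : CubeCell n p (d + 1)) (i : Fin n) (ε : ℕ) (G : CubeCell n p d) : Prop :=
  G.base = F.base + Pi.single i ε ∧ G.dirs = F.dirs.erase i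

instance (F : CubeCell n p (d + 1)) (i : Fin n) (ε : ℕ) (G : CubeCell n p d) :
    Decidable (F.IsFacet i ε G) := instDecidableAnd

theorem isFacet_iff {F : CubeCell n p (d + 1)} {i : Fin n} {hi : i ∈ F.dirs} {ε : ℕ}
    {hε : ε ≤ 1} {G : CubeCell n p d} : F.IsFacet i ε G ↔ G = F.facet i hi ε hε :=
  ⟨fun h => ext' h.1 h.2, fun h => by subst h; exact ⟨rfl, rfl⟩⟩

theorem mapsTo_sphere (c : CubeCell n p d) :
    MapsTo c.charFun (sphere 0 1)
      (⋃ (m < d) (j : CubeCell n p m), j.charFun '' closedBall 0 1) := by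
  intro u hu
  have hc : c.charFun u ∈ Icc c.lo c.hi := by
    rw [← charFun_image_closedBall]
    exact mem_image_of_mem _ (sphere_subset_closedBall hu)
  rw [mem_sphere_zero_iff_norm] at hu
  obtain ⟨j, hj⟩ : ∃ j, |u j| = 1 := by
    by_contra! h
    have : ‖u‖ < 1 := (pi_norm_lt_iff one_pos).2 fun j =>
      lt_of_le_of_ne (hu ▸ norm_le_pi_norm u j) (h j)
    exact this.ne hu
  have hd : d = (d - 1) + 1 := by have := j.2; omega
  obtain ⟨m, rfl⟩ : ∃ m, d = m + 1 := ⟨_, hd⟩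
  set i : Fin n := (c.dirs.orderIsoOfFin c.card_dirs j).1 with hi
  have hmem : i ∈ c.dirs := (c.dirs.orderIsoOfFin c.card_dirs j).2
  have hval : c.charFun u i = c.base i + (1 + u j) / 2 := by
    have hsymm : (c.dirs.orderIsoOfFin c.card_dirs).symm ⟨i, hmem⟩ = j :=
      (c.dirs.orderIsoOfFin c.card_dirs).symm_apply_apply j
    simp only [charFun, hmem, dite_true, hsymm]
  have main : ∀ ε : ℕ, ∀ hε : ε ≤ 1, c.charFun u i = c.base i + ε →
      c.charFun u ∈ Icc (c.facet i hmem ε hε).lo (c.facet i hmem ε hε).hi := by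
    intro ε hε h
    refine ⟨fun l => ?_, fun l => ?_⟩ <;> by_cases hl : l = i
    · rw [hl, h]; simp [lo, facet]
    · have := hc.1 l
      simpa [lo, facet, hl] using this
    · rw [hl, h]; simp [CubeCell.hi, facet]
    · have := hc.2 l
      simpa [CubeCell.hi, facet, hl] using this
  simp only [mem_iUnion, charFun_image_closedBall]
  rcases eq_or_eq_neg_of_abs_eq hj with h | h
  · exact ⟨m, Nat.lt_succ_self m, _, main 1 le_rfl (by rw [hval, h]; norm_num)⟩
  · exact ⟨m, Nat.lt_succ_self m, _, main 0 zero_le_one (by rw [hval, h]; norm_num)⟩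

theorem iUnion_closedBall (n p : ℕ) :
    ⋃ (d : ℕ) (c : CubeCell n p d), c.charFun '' closedBall 0 1 =
      Icc (0 : Fin n → ℝ) (fun _ => (p : ℝ)) := by
  apply Subset.antisymm
  · refine iUnion₂_subset fun d c => ?_
    rw [charFun_image_closedBall]
    refine Icc_subset_Icc (fun i => ?_) (fun i => ?_)
    · simp [lo]
    · simp only [CubeCell.hi]
      split_ifs with h
      · exact_mod_cast c.base_lt h
      · simpa using c.base_le i
  · rintro z ⟨h0, h1⟩
    simp only [mem_iUnion, charFun_image_closedBall]
    have hle : ∀ i, ⌊z i⌋₊ ≤ p := fun i => Nat.floor_le_of_le (h1 i)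
    classical
    refine ⟨_, mk (fun i => ⌊z i⌋₊) {i | z i ≠ ⌊z i⌋₊} hle rfl fun i hi' => ?_, ?_, ?_⟩
    · simp only [Finset.mem_filter, Finset.mem_univ, true_and] at hi'
      refine lt_of_le_of_ne (hle i) fun h => hi' (le_antisymm ?_ (Nat.floor_le (h0 i)))
      rw [h]
      exact h1 i
    · intro i
      exact Nat.floor_le (h0 i)
    · intro i
      simp only [CubeCell.hi, base_mk, dirs_mk, Finset.mem_filter, Finset.mem_univ, true_and]
      split_ifs with h
      · exact (Nat.lt_floor_add_one _).le
      · simp only [ne_eq, not_not] at h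
        linarith

/-- The orientation of the cubical cells as products of intervals: the facets of `F` in the
direction number `r` (counted from `0`) of `F` get the sign `(-1) ^ r` at the upper end, and
`-(-1) ^ r` at the lower end. -/
def sign (F : CubeCell n p (d + 1)) (G : CubeCell n p d) : ℤ :=
  ∑ i ∈ F.dirs, (-1) ^ (F.dirs.filter (· < i)).card *
    ((if F.IsFacet i 1 G then 1 else 0) - (if F.IsFacet i 0 G then 1 else 0))

theorem sum_isFacet (F : CubeCell n p (d + 1)) {i : Fin n} (hi : i ∈ F.dirs) {ε : ℕ}
    (hε : ε ≤ 1) (h : CubeCell n p d → ℤ) :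
    ∑ G, (if F.IsFacet i ε G then 1 else 0) * h G = h (F.facet i hi ε hε) := by
  rw [Finset.sum_eq_single (F.facet i hi ε hε)]
  · rw [if_pos (isFacet_iff.2 rfl), one_mul]
  · intro G _ hG
    rw [if_neg fun h' => hG (isFacet_iff.1 h'), zero_mul]
  · simp

theorem sum_sign_mul (F : CubeCell n p (d + 1)) (h : CubeCell n p d → ℤ) :
    ∑ G, F.sign G * h G = ∑ i : F.dirs, (-1) ^ (F.dirs.filter (· < i.1)).card *
      (h (F.facet i.1 i.2 1 le_rfl) - h (F.facet i.1 i.2 0 zero_le_one)) := by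
  simp only [sign, Finset.sum_mul]
  rw [Finset.sum_comm, ← Finset.sum_coe_sort]
  refine Finset.sum_congr rfl fun i _ => ?_
  rw [← sum_isFacet F i.2 le_rfl h, ← sum_isFacet F i.2 zero_le_one h, ← Finset.sum_sub_distrib,
    Finset.mul_sum]
  refine Finset.sum_congr rfl fun G _ => ?_
  ring

theorem sum_sign_edge (F : CubeCell n p 1) : ∑ G, F.sign G = 0 := by
  have := F.sum_sign_mul (fun _ => 1)
  simpa using this

theorem sum_sign_mul_sign (F : CubeCell n p (d + 2)) (H : CubeCell n p d) :
    ∑ G, F.sign G * G.sign H = 0 := by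
  rw [sum_sign_mul F (fun G => G.sign H)]
  let ind : Fin n → Fin n → ℕ → ℕ → ℤ := fun i j ε δ =>
    if H.base = F.base + Pi.single i ε + Pi.single j δ ∧ H.dirs = (F.dirs.erase i).erase j
    then 1 else 0
  have ind_symm : ∀ i j ε δ, ind i j ε δ = ind j i δ ε := by
    intro i j ε δ
    simp only [ind]
    rw [add_right_comm, Finset.erase_right_comm]
  let T : Fin n → Fin n → ℤ := fun i j =>
    if i ∈ F.dirs ∧ j ∈ F.dirs ∧ i ≠ j then
      (-1) ^ (F.dirs.filter (· < i)).card * ((-1) ^ ((F.dirs.erase i).filter (· < j)).card *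
        (ind i j 1 1 - ind i j 1 0 - (ind i j 0 1 - ind i j 0 0))) else 0
  have hsign : ∀ i j, i ∈ F.dirs → j ∈ F.dirs → i < j →
      (-1 : ℤ) ^ ((F.dirs.erase i).filter (· < j)).card = - (-1) ^ (F.dirs.filter (· < j)).card ∧
      (F.dirs.erase j).filter (· < i) = F.dirs.filter (· < i) := by
    intro i j hi hj hij
    constructor
    · rw [Finset.filter_erase, Finset.card_erase_of_mem (by simp [hi, hij])]
      have hpos : 0 < (F.dirs.filter (· < j)).card :=
        Finset.card_pos.2 ⟨i, by simp [hi, hij]⟩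
      obtain ⟨r, hr⟩ := Nat.exists_eq_succ_of_ne_zero hpos.ne'
      rw [hr]
      simp [pow_succ]
    · rw [Finset.filter_erase, Finset.erase_eq_of_notMem]
      simp [hij.le]
  have hT' : ∀ i j, i < j → T i j = - T j i := by
    intro i j hij
    simp only [T]
    by_cases h : i ∈ F.dirs ∧ j ∈ F.dirs
    · rw [if_pos ⟨h.1, h.2, hij.ne⟩, if_pos ⟨h.2, h.1, hij.ne'⟩]
      obtain ⟨h1, h2⟩ := hsign i j h.1 h.2 hij
      rw [h1, h2, ind_symm j i 1 1, ind_symm j i 1 0, ind_symm j i 0 1, ind_symm j i 0 0]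
      ring
    · rw [if_neg (by tauto), if_neg (by tauto), neg_zero]
  have hT : ∀ i j, T i j = - T j i := by
    intro i j
    rcases lt_trichotomy i j with h | h | h
    · exact hT' i j h
    · subst h; simp [T]
    · rw [hT' j i h, neg_neg]
  have hzero : ∑ i, ∑ j, T i j = 0 := by
    have h1 : ∑ i, ∑ j, T i j = ∑ i, ∑ j, - T i j := by
      rw [Finset.sum_comm]
      exact Finset.sum_congr rfl fun i _ => Finset.sum_congr rfl fun j _ => hT j i
    simp only [Finset.sum_neg_distrib] at h1
    linarith
  let g : Fin n → ℤ := fun i => if hi : i ∈ F.dirs then (-1) ^ (F.dirs.filter (· < i)).card *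
    ((F.facet i hi 1 le_rfl).sign H - (F.facet i hi 0 zero_le_one).sign H) else 0
  rw [← hzero]
  trans ∑ i : F.dirs, g i.1
  · refine Finset.sum_congr rfl fun i _ => ?_
    simp only [g]
    rw [dif_pos i.2]
  · rw [Finset.sum_coe_sort F.dirs g]
    rw [← Finset.sum_subset (Finset.subset_univ F.dirs)]
    · refine Finset.sum_congr rfl fun i hi => ?_
      simp only [g]
      rw [dif_pos hi]
      rw [← Finset.sum_subset (Finset.subset_univ (F.dirs.erase i))]
      · simp only [sign]
        rw [show (F.facet i hi 1 le_rfl).dirs = F.dirs.erase i from rfl,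
          show (F.facet i hi 0 zero_le_one).dirs = F.dirs.erase i from rfl,
          ← Finset.sum_sub_distrib, Finset.mul_sum]
        refine Finset.sum_congr rfl fun j hj => ?_
        have hTij : T i j = _ :=
          if_pos ⟨hi, Finset.mem_of_mem_erase hj, (Finset.ne_of_mem_erase hj).symm⟩
        rw [hTij, ← mul_sub]
        rfl
      · intro j _ hj
        simp only [T]
        rw [if_neg]
        rintro ⟨_, h2, h3⟩
        exact hj (Finset.mem_erase.2 ⟨h3.symm, h2⟩)
    · intro i _ hi
      refine Finset.sum_eq_zero fun j _ => ?_
      simp [T, hi]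

theorem Icc_subset_of_isFacet {F : CubeCell n p (d + 1)} {i : Fin n} {ε : ℕ} {G : CubeCell n p d}
    (hi : i ∈ F.dirs) (hε : ε ≤ 1) (h : F.IsFacet i ε G) : Icc G.lo G.hi ⊆ Icc F.lo F.hi := by
  refine Icc_subset_Icc (fun j => ?_) (fun j => ?_)
  · simp [lo, h.1]
  · by_cases hj : j = i
    · subst hj
      simp only [CubeCell.hi, h.1, h.2, hi]
      simpa using hε
    · simp [CubeCell.hi, h.1, h.2, hj]

theorem sign_eq_zero {F : CubeCell n p (d + 1)} {G : CubeCell n p d}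
    (h : ¬ Icc G.lo G.hi ⊆ Icc F.lo F.hi) : F.sign G = 0 := by
  refine Finset.sum_eq_zero fun i hi => ?_
  rw [if_neg fun h' => h (Icc_subset_of_isFacet hi le_rfl h'),
    if_neg fun h' => h (Icc_subset_of_isFacet hi zero_le_one h'), sub_zero, mul_zero]

theorem sign_eq_or {F : CubeCell n p (d + 1)} {G : CubeCell n p d}
    (h : Icc G.lo G.hi ⊆ Icc F.lo F.hi) : F.sign G = 1 ∨ F.sign G = -1 := by
  rw [Icc_subset_Icc_iff G.lo_le_hi] at h
  have hlo : ∀ j, F.base j ≤ G.base j := fun j => by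
    have := h.1 j
    simpa [lo] using this
  have hhi : ∀ j, G.base j + (if j ∈ G.dirs then 1 else 0) ≤
      F.base j + if j ∈ F.dirs then 1 else 0 := fun j => by
    have := h.2 j
    simp only [CubeCell.hi] at this
    split_ifs at this ⊢ <;> exact_mod_cast this
  have hsub : G.dirs ⊆ F.dirs := fun j hj => by
    by_contra hj'
    have h1 := hlo j
    have h2 := hhi j
    simp only [hj, hj', if_true, if_false] at h2
    omega
  obtain ⟨i, hi⟩ : ∃ i, F.dirs \ G.dirs = {i} := by
    rw [← Finset.card_eq_one, Finset.card_sdiff_of_subset hsub, F.card_dirs, G.card_dirs]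
    omega
  have hiF : i ∈ F.dirs ∧ i ∉ G.dirs := by
    rw [← Finset.mem_sdiff, hi]
    exact Finset.mem_singleton_self i
  have hdirs : G.dirs = F.dirs.erase i := by
    rw [Finset.erase_eq, ← hi, Finset.sdiff_sdiff_eq_self hsub]
  have hother : ∀ j, j ≠ i → G.base j = F.base j := fun j hj => by
    have h1 := hlo j
    have h2 := hhi j
    have : j ∈ G.dirs ↔ j ∈ F.dirs := by rw [hdirs]; simp [hj]
    simp only [this] at h2
    omega
  have hval : G.base i = F.base i ∨ G.base i = F.base i + 1 := by
    have h1 := hlo i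
    have h2 := hhi i
    simp only [hiF.1, hiF.2, if_true, if_false] at h2
    omega
  have hunique : ∀ j ∈ F.dirs, ∀ ε, F.IsFacet j ε G → j = i := fun j hj ε h' => by
    have h2 := h'.2
    rw [hdirs] at h2
    by_contra hne
    have : j ∈ F.dirs.erase i := Finset.mem_erase.2 ⟨hne, hj⟩
    rw [h2] at this
    simp at this
  have hfac : ∀ ε, F.IsFacet i ε G ↔ G.base i = F.base i + ε := fun ε => by
    constructor
    · intro h'
      simpa using congrFun h'.1 i
    · intro h'
      refine ⟨funext fun j => ?_, hdirs⟩
      by_cases hj : j = i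
      · subst hj; simpa using h'
      · simpa [hj] using hother j hj
  rw [sign, Finset.sum_eq_single_of_mem i hiF.1]
  · rcases neg_one_pow_eq_or ℤ (F.dirs.filter (· < i)).card with hs | hs <;>
      rcases hval with hv | hv <;> simp [hs, hfac, hv]
  · intro j hj hne
    rw [if_neg fun h' => hne (hunique j hj _ h'), if_neg fun h' => hne (hunique j hj _ h')]
    simp

theorem eventually_isEmpty (n p : ℕ) : ∀ᶠ d in Filter.atTop, IsEmpty (CubeCell n p d) :=
  Filter.eventually_atTop.2 ⟨n + 1, fun d hd => ⟨fun c => by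
    have h := c.dirs.card_le_univ
    rw [c.card_dirs, Fintype.card_fin] at h
    omega⟩⟩

end CubeCell

/-- The decomposition of `[0, p]^n` into cubical cells, as a CW complex. -/
noncomputable instance cubeCW (n p : ℕ) :
    Topology.CWComplex (Icc (0 : Fin n → ℝ) (fun _ => (p : ℝ))) :=
  Topology.CWComplex.mkFinite _ (fun d => CubeCell n p d) (fun _ c => c.charMap)
    (CubeCell.eventually_isEmpty n p)
    (fun _ => inferInstance)
    (fun _ _ => rfl)
    (fun _ c => c.continuous_charFun.continuousOn)
    (fun _ c => c.continuous_charInv.continuousOn)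
    (by
      rintro ⟨d, c⟩ _ ⟨e, c'⟩ _ hne
      refine disjoint_left.2 fun z hz hz' => hne ?_
      obtain ⟨h1, h2⟩ := c.eq_of_mem_ball c' hz hz'
      obtain rfl : d = e := by rw [← c.card_dirs, ← c'.card_dirs, h2]
      rw [CubeCell.ext' h1 h2])
    (fun _ c => c.mapsTo_sphere)
    (CubeCell.iUnion_closedBall n p)

/-! ### Labelled cell complexes and their cellular complexes -/

/-- A labelled cell complex: a finite regular CW complex whose vertices carry monomials in the
variables `σ` (given by their exponent vectors), together with an orientation of its cells,
recorded by the incidence numbers `sign` of the cellular chain complex. -/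
structure LabelledCellComplex (σ : Type) where
  /-- The ambient space. -/
  space : Type
  [topologicalSpace : TopologicalSpace space]
  [t2Space : T2Space space]
  /-- The underlying space of the complex. -/
  carrier : Set space
  [cwComplex : Topology.CWComplex carrier]
  [fintypeCell : ∀ d, Fintype (Topology.CWComplex.cell carrier d)]
  eventually_isEmpty : ∀ᶠ d in Filter.atTop, IsEmpty (Topology.CWComplex.cell carrier d)
  /-- Regularity: the characteristic maps are embeddings of closed balls. -/
  regular : ∀ d (F : Topology.CWComplex.cell carrier d),
    InjOn (Topology.CWComplex.map (C := carrier) d F) (closedBall 0 1)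
  /-- The exponent vectors of the labels of the vertices. -/
  vertexLabel : Topology.CWComplex.cell carrier 0 → σ →₀ ℕ
  /-- The incidence numbers: nonzero, and then `1` or `-1`, exactly for the facets of a cell. -/
  sign : ∀ {d : ℕ}, Topology.CWComplex.cell carrier (d + 1) →
    Topology.CWComplex.cell carrier d → ℤ
  sign_eq_zero : ∀ {d : ℕ} (F : Topology.CWComplex.cell carrier (d + 1))
    (G : Topology.CWComplex.cell carrier d),
    ¬ Topology.CWComplex.closedCell (C := carrier) d G ⊆ Topology.CWComplex.closedCell (C := carrier) (d + 1) F → sign F G = 0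
  sign_eq_or : ∀ {d : ℕ} (F : Topology.CWComplex.cell carrier (d + 1))
    (G : Topology.CWComplex.cell carrier d),
    Topology.CWComplex.closedCell (C := carrier) d G ⊆ Topology.CWComplex.closedCell (C := carrier) (d + 1) F →
      sign F G = 1 ∨ sign F G = -1
  /-- The two end points of an edge have opposite signs. -/
  sum_sign_edge : ∀ F : Topology.CWComplex.cell carrier 1, ∑ G, sign F G = 0
  /-- The boundary of a boundary is zero. -/
  sum_sign_mul_sign : ∀ {d : ℕ} (F : Topology.CWComplex.cell carrier (d + 2))
    (H : Topology.CWComplex.cell carrier d), ∑ G, sign F G * sign G H = 0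

namespace LabelledCellComplex

attribute [instance] topologicalSpace t2Space cwComplex fintypeCell

variable {σ : Type} (X Y Z : LabelledCellComplex σ)

/-- The cells of dimension `d`. -/
abbrev Cell (d : ℕ) : Type := Topology.CWComplex.cell X.carrier d

/-- The closed cell, as a set of points. -/
abbrev closedCell {d : ℕ} (F : X.Cell d) : Set X.space := Topology.CWComplex.closedCell (C := X.carrier) d F

/-- The faces of dimension `i - 1`; the only face of dimension `-1` is the empty face. -/
def Face : ℕ → Type
  | 0 => Unit
  | d + 1 => X.Cell d

/-- The empty face. -/
def emptyFace : X.Face 0 := ()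

/-- A `d`-cell as a face. -/
def toFace {d : ℕ} (F : X.Cell d) : X.Face (d + 1) := F

noncomputable instance fintypeFace : ∀ i, Fintype (X.Face i)
  | 0 => inferInstanceAs (Fintype Unit)
  | d + 1 => inferInstanceAs (Fintype (X.Cell d))

open Classical in
/-- The label of a cell: the least common multiple of the labels of its vertices. -/
noncomputable def cellLabel {d : ℕ} (F : X.Cell d) : σ →₀ ℕ :=
  (Finset.univ.filter fun v : X.Cell 0 => X.closedCell v ⊆ X.closedCell F).sup X.vertexLabel

/-- The label of a face; the empty face has label `1`. -/
noncomputable def label : ∀ {i : ℕ}, X.Face i → σ →₀ ℕ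
  | 0, _ => 0
  | _ + 1, F => X.cellLabel F

/-- The incidence numbers of faces; every vertex has incidence number `1` with the empty face. -/
def faceSign : ∀ {i : ℕ}, X.Face (i + 1) → X.Face i → ℤ
  | 0, _, _ => 1
  | _ + 1, F, G => X.sign F G

variable (k : Type*) [Field k]

/-- The `i`-th module of the cellular complex: the free module over the polynomial ring on the
faces of dimension `i - 1`. -/
abbrev Mod (i : ℕ) : Type _ := X.Face i →₀ MvPolynomial σ k

/-- The differential of the cellular complex,
`∂ F = ∑ G, sign (F, G) x ^ (a_F - a_G) G`, the sum over the faces `G` of codimension one. -/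
noncomputable def diff (i : ℕ) : X.Mod k (i + 1) →ₗ[MvPolynomial σ k] X.Mod k i :=
  Finsupp.linearCombination (MvPolynomial σ k) fun F : X.Face (i + 1) =>
    ∑ G : X.Face i, Finsupp.single G
      (MvPolynomial.monomial (X.label F - X.label G) (X.faceSign F G : k))

/-- The complex `X` supports a (cellular) resolution of `S / I`, `S` the polynomial ring: its
cellular complex has no homology in positive degrees, and the image of the last differential is
the submodule of `S` (the free module on the empty face) given by the ideal `I`. -/
def SupportsResolution (I : Ideal (MvPolynomial σ k)) : Prop :=
  (∀ i, Function.Exact (X.diff k (i + 1)) (X.diff k i)) ∧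
    (LinearMap.range (X.diff k 0)).map
      (Finsupp.lapply (R := MvPolynomial σ k) (M := MvPolynomial σ k) X.emptyFace) = I

/-- The `t`-th syzygy module, the image of the `(t + 1)`-st module of the cellular complex in the
`t`-th one. For `t = 0` this is `I`, if `X` supports a resolution of `S / I`. -/
noncomputable def syzygy (t : ℕ) : Submodule (MvPolynomial σ k) (X.Mod k t) :=
  LinearMap.range (X.diff k t)

/-! ### Morphisms -/

variable {X Y} in
/-- A chain map `f` (with degree `0` component between the copies of the polynomial ring) and a
continuous map `g` are compatible, where `g` takes `d`-cells to `d`-cells: if `g` maps the cell `x`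
to the cell `y`, then `f₀` maps the label of `x` to that of `y`, and `f` maps the basis element
of `x` to a nonzero multiple of that of `y`. -/
def Compatible (f : ∀ i, X.Mod k i →ₗ[MvPolynomial σ k] Y.Mod k i) (g : C(X.carrier, Y.carrier)) :
    Prop :=
  ∀ (d : ℕ) (x : X.Cell d), ∃ y : Y.Cell d,
    (fun z => (g z : Y.space)) '' (Subtype.val ⁻¹' X.closedCell x) = Y.closedCell y ∧
    f 0 (Finsupp.single X.emptyFace (MvPolynomial.monomial (X.cellLabel x) 1)) =
      Finsupp.single Y.emptyFace (MvPolynomial.monomial (Y.cellLabel y) 1) ∧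
    ∃ c : MvPolynomial σ k, c ≠ 0 ∧
      f (d + 1) (Finsupp.single (X.toFace x) 1) =
        Finsupp.single (Y.toFace y) c

/-- A morphism between the cellular complexes of `X` and `Y`: a compatible pair of a chain map
and a cellular map that takes `d`-cells to `d`-cells. -/
@[ext]
structure CellMorphism where
  /-- The chain map. -/
  chain : ∀ i, X.Mod k i →ₗ[MvPolynomial σ k] Y.Mod k i
  /-- The cellular map. -/
  map : C(X.carrier, Y.carrier)
  comm : ∀ i v, chain i (X.diff k i v) = Y.diff k i (chain (i + 1) v)
  compatible : Compatible k chain map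

namespace CellMorphism

variable {k} {X Y Z}

/-- The identity morphism. -/
noncomputable def id (X : LabelledCellComplex σ) : CellMorphism X X k where
  chain _ := LinearMap.id
  map := ContinuousMap.id _
  comm _ _ := rfl
  compatible d x := by
    refine ⟨x, ?_, rfl, 1, one_ne_zero, rfl⟩
    have h : X.closedCell x ⊆ X.carrier := Topology.CWComplex.closedCell_subset_complex (C := X.carrier) d x
    have h' := Subtype.image_preimage_coe X.carrier (X.closedCell x)
    rw [inter_eq_right.2 h] at h'
    exact h'

/-- The composition of morphisms. -/
noncomputable def comp (φ : CellMorphism X Y k) (ψ : CellMorphism Y Z k) :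
    CellMorphism X Z k where
  chain i := (ψ.chain i).comp (φ.chain i)
  map := ψ.map.comp φ.map
  comm i v := by
    simp only [LinearMap.comp_apply]
    rw [φ.comm, ψ.comm]
  compatible d x := by
    obtain ⟨y, hy, hl, c, hc, hf⟩ := φ.compatible d x
    obtain ⟨z, hz, hl', c', hc', hf'⟩ := ψ.compatible d y
    refine ⟨z, ?_, ?_, c * c', mul_ne_zero hc hc', ?_⟩
    · rw [← hz, ← hy]
      ext w
      constructor
      · rintro ⟨u, hu, rfl⟩
        exact ⟨φ.map u, ⟨u, hu, rfl⟩, rfl⟩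
      · rintro ⟨v, ⟨u, hu, huv⟩, rfl⟩
        refine ⟨u, hu, ?_⟩
        have : φ.map u = v := Subtype.ext huv
        rw [← this]
        rfl
    · rw [LinearMap.comp_apply, hl, hl']
    · rw [LinearMap.comp_apply, hf]
      have : (Finsupp.single (Y.toFace y) c : Y.Mod k (d + 1)) =
          c • Finsupp.single (Y.toFace y) 1 := by
        rw [Finsupp.smul_single, smul_eq_mul, mul_one]
      rw [this, map_smul, hf', Finsupp.smul_single, smul_eq_mul]

/-- A morphism is a multiplication by a monomial if its component `f₀ : S → S` is. -/
def IsMultiplication (φ : CellMorphism X Y k) : Prop :=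
  ∃ m : σ →₀ ℕ, φ.chain 0 (Finsupp.single X.emptyFace 1) =
    Finsupp.single Y.emptyFace (MvPolynomial.monomial m 1)

theorem isMultiplication_id (X : LabelledCellComplex σ) :
    (id X : CellMorphism X X k).IsMultiplication :=
  ⟨0, rfl⟩

theorem IsMultiplication.comp {φ : CellMorphism X Y k} {ψ : CellMorphism Y Z k}
    (hφ : φ.IsMultiplication) (hψ : ψ.IsMultiplication) : (φ.comp ψ).IsMultiplication := by
  obtain ⟨m, hm⟩ := hφ
  obtain ⟨m', hm'⟩ := hψ
  refine ⟨m + m', ?_⟩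
  have : (Finsupp.single Y.emptyFace (MvPolynomial.monomial m 1) : Y.Mod k 0) =
      (MvPolynomial.monomial m (1 : k)) • Finsupp.single Y.emptyFace 1 := by
    rw [Finsupp.smul_single, smul_eq_mul, mul_one]
  change ψ.chain 0 (φ.chain 0 _) = _
  rw [hm, this, map_smul, hm', Finsupp.smul_single, smul_eq_mul, MvPolynomial.monomial_mul, one_mul]

/-- The map induced by a morphism on the `t`-th syzygy modules, the restriction of the chain
map. -/
noncomputable def syzygyMap (φ : CellMorphism X Y k) (t : ℕ) :
    X.syzygy k t →ₗ[MvPolynomial σ k] Y.syzygy k t :=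
  (φ.chain t).restrict (by
    rintro _ ⟨v, rfl⟩
    exact ⟨φ.chain (t + 1) v, (φ.comm t v).symm⟩)

end CellMorphism

end LabelledCellComplex

/-! ### Representations of a category -/

/-- A subrepresentation of a representation `M` of a category `C` over a ring `R`. -/
structure CategorySubrep {R : Type*} [Ring R] {C : Type*} [CategoryTheory.Category C]
    (M : CategoryTheory.Functor C (ModuleCat R)) where
  /-- The submodule at an object. -/
  obj : ∀ x : C, Submodule R (M.obj x)
  map_mem : ∀ {x y : C} (f : x ⟶ y), ∀ v ∈ obj x, (M.map f).hom v ∈ obj y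

/-- A representation is finitely generated if some finite set of its elements lies in no
subrepresentation but the whole one. -/
def IsFinitelyGeneratedRep {R : Type*} [Ring R] {C : Type*} [CategoryTheory.Category C]
    (M : CategoryTheory.Functor C (ModuleCat R)) : Prop :=
  ∃ T : Set (Σ x : C, M.obj x), T.Finite ∧
    ∀ N : CategorySubrep M, (∀ e ∈ T, e.2 ∈ N.obj e.1) → ∀ x, N.obj x = ⊤

/-! ### Subdivided cubes and cube ideals -/

/-- The subdivided cube `C_n^p`: the cube `[0, p]^n` cut into unit cubes. The bijection `P` pairs
the variables: the pair of the direction `i` consists of the variables number `P (i, 0)` and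
`P (i, 1)`, and the vertex `a` has the label `∏ i, x_{P (i, 0)} ^ (p - a i) * x_{P (i, 1)} ^ a i`. -/
noncomputable def subdividedCube {n : ℕ} (P : Fin n × Fin 2 ≃ Fin (2 * n)) (p : ℕ) :
    LabelledCellComplex (Fin (2 * n)) where
  space := Fin n → ℝ
  carrier := Icc (0 : Fin n → ℝ) (fun _ => (p : ℝ))
  cwComplex := cubeCW n p
  fintypeCell d := inferInstanceAs (Fintype (CubeCell n p d))
  eventually_isEmpty := CubeCell.eventually_isEmpty n p
  regular _ F := (CubeCell.charFun_injective F).injOn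
  vertexLabel := fun v : CubeCell n p 0 =>
    ∑ i, (Finsupp.single (P (i, 0)) (p - v.base i) + Finsupp.single (P (i, 1)) (v.base i))
  sign := fun {d} (F : CubeCell n p (d + 1)) (G : CubeCell n p d) => F.sign G
  sign_eq_zero := fun {d} (F : CubeCell n p (d + 1)) (G : CubeCell n p d) h =>
    CubeCell.sign_eq_zero (by
      rw [← CubeCell.charFun_image_closedBall, ← CubeCell.charFun_image_closedBall]
      exact h)
  sign_eq_or := fun {d} (F : CubeCell n p (d + 1)) (G : CubeCell n p d) h =>
    CubeCell.sign_eq_or (by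
      rw [← CubeCell.charFun_image_closedBall, ← CubeCell.charFun_image_closedBall]
      exact h)
  sum_sign_edge F := CubeCell.sum_sign_edge F
  sum_sign_mul_sign F H := CubeCell.sum_sign_mul_sign F H

/-- The cube ideal of a pairing, generated by the products of one variable from each pair. -/
noncomputable def cubeIdeal (k : Type*) [Field k] {n : ℕ} (P : Fin n × Fin 2 ≃ Fin (2 * n)) :
    Ideal (MvPolynomial (Fin (2 * n)) k) :=
  Ideal.span (range fun e : Fin n → Fin 2 => ∏ i, MvPolynomial.X (P (i, e i)))

/-- The objects of the family of the cellular complexes of the cubes `C_n^p`, `p ≥ 1`. -/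
@[ext]
structure CubeFamily (k : Type*) [Field k] {n : ℕ} (P : Fin n × Fin 2 ≃ Fin (2 * n)) where
  /-- The number of parts of the edges. -/
  p : ℕ
  one_le : 1 ≤ p

namespace CubeFamily

variable {k : Type*} [Field k] {n : ℕ} {P : Fin n × Fin 2 ≃ Fin (2 * n)}

/-- The cell complex that supports a member of the family. -/
noncomputable abbrev cube (A : CubeFamily k P) : LabelledCellComplex (Fin (2 * n)) :=
  subdividedCube P A.p

/-- A point of the cube as a vector. -/
def point {A : CubeFamily k P} (z : A.cube.carrier) : Fin n → ℝ := z.1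

/-- The cellular map of a morphism of cubes is (the restriction of) a translation of `ℝ^n`. -/
def IsTranslation {A B : CubeFamily k P}
    (φ : LabelledCellComplex.CellMorphism A.cube B.cube k) : Prop :=
  ∃ t : Fin n → ℝ, ∀ z : A.cube.carrier, point (φ.map z) = point z + t

/-- The morphisms of the family are the multiplications by monomials. The chain map determines to
which cell each cell is mapped; the condition that the cellular map be a translation selects one
cellular map for each chain map. -/
def Hom (A B : CubeFamily k P) : Type _ :=
  {φ : LabelledCellComplex.CellMorphism A.cube B.cube k // φ.IsMultiplication ∧ IsTranslation φ}

noncomputable instance : CategoryTheory.Category (CubeFamily k P) where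
  Hom := Hom
  id A := ⟨LabelledCellComplex.CellMorphism.id A.cube,
    LabelledCellComplex.CellMorphism.isMultiplication_id _, 0, fun z => (add_zero (point z)).symm⟩
  comp φ ψ := ⟨φ.1.comp ψ.1, φ.2.1.comp ψ.2.1, by
    obtain ⟨t, ht⟩ := φ.2.2
    obtain ⟨t', ht'⟩ := ψ.2.2
    refine ⟨t + t', fun z => ?_⟩
    rw [← add_assoc, ← ht z]
    exact ht' (φ.1.map z)⟩

/-- `C_n^p` is covered by `C_n^q`: there are morphisms, and the images of their cellular maps
together are the whole complex. -/
def Covers (A B : CubeFamily k P) : Prop :=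
  Nonempty (Hom A B) ∧ ⋃ φ : Hom A B, range φ.1.map = univ

variable (k P) in
/-- The `t`-th syzygy representation of the family. -/
noncomputable def syzygyRep (t : ℕ) :
    CategoryTheory.Functor (CubeFamily k P) (ModuleCat (MvPolynomial (Fin (2 * n)) k)) where
  obj A := ModuleCat.of _ (A.cube.syzygy k t)
  map {A B} (φ : Hom A B) := ModuleCat.ofHom (φ.1.syzygyMap t)
  map_id _ := rfl
  map_comp _ _ := rfl

end CubeFamily

/-! For the resolution, the differential preserves multidegrees, so exactness can be tested one
monomial `x^b` at a time. The strand of degree `b` is the augmented cellular chain complex over `k`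
of the cells whose labels divide `x^b` (`exact_diff_of_acyclic`). For a subdivided cube the label of
a cell has the `y`-exponents of its lowest corner and the `z`-exponents of its highest corner, so
these cells are exactly the ones in a box of unit cubes, possibly empty
(`cellLabel_subdividedCube_le_iff`). A box is acyclic because it can be pushed onto its corner one
direction at a time: `bdry_prism` is the chain homotopy for one direction, and `exists_bdry_eq`
draws the conclusion. The image in `S` is generated by the vertex labels, and these are the `p`-fold
products of generators of the cube ideal, since the choices in different directions are independent
(`cubeIdeal_pow`).

For the other two claims, a translation of a small cube into a large one multiplies all cell labels
by one fixed monomial. The quotients of labels in the differential do not change, so the translation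
is a morphism (`translateMorphism`). Every point and every cell of `C_n^p` lies in a translated unit
cube. This gives the covering, and it shows that the boundaries of the finitely many cells of
`C_n^1` generate every syzygy module of the family. -/

/-! ### Cellular chains of the lattice of unit cubes -/

/-- The cells of `ℕ^n` cut into unit cubes: a lower corner and a set of directions. -/
abbrev LatticeCell (n : ℕ) : Type := (Fin n → ℕ) × Finset (Fin n)

namespace LatticeCell

variable {n : ℕ}

/-- The sign of the upper facet of a cell with directions `D` in the direction `i`. -/
def orient (D : Finset (Fin n)) (i : Fin n) : ℤ := (-1) ^ (D.filter (· < i)).card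

theorem orient_mul_self (D : Finset (Fin n)) (i : Fin n) : orient D i * orient D i = 1 := by
  rw [orient, ← pow_add, Even.neg_one_pow ⟨_, rfl⟩]

theorem orient_erase_self (D : Finset (Fin n)) (i : Fin n) :
    orient (D.erase i) i = orient D i := by
  rw [orient, orient, Finset.filter_erase, Finset.erase_eq_of_notMem (by simp)]

theorem orient_insert_self (D : Finset (Fin n)) (i : Fin n) :
    orient (insert i D) i = orient D i := by
  rw [orient, orient, Finset.filter_insert, if_neg (lt_irrefl i)]

/-- Exactly one of two things happens: if `j < i`, erasing `j` flips the sign of `i`; if `i < j`,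
inserting `i` flips the sign of `j`. This is the sign that cancels the lateral terms in the homotopy
formula. -/
theorem orient_mul_orient_erase {D : Finset (Fin n)} {i j : Fin n} (hi : i ∉ D) (hj : j ∈ D) :
    orient D j * orient (D.erase j) i = -(orient D i * orient (insert i D) j) := by
  have hne : j ≠ i := fun h => hi (h ▸ hj)
  simp only [orient, Finset.filter_erase, Finset.filter_insert]
  rcases lt_or_gt_of_ne hne with h | h
  · have hmem : j ∈ D.filter (· < i) := by simp [hj, h]
    rw [if_neg h.not_gt, ← Finset.card_erase_add_one hmem, pow_succ]
    ring
  · rw [if_pos h, Finset.erase_eq_of_notMem (by simp [h.le]),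
      Finset.card_insert_of_notMem (by simp [hi]), pow_succ]
    ring

variable (R : Type*) [CommRing R]

/-- The boundary map of the cellular chains of the lattice. -/
noncomputable def bdry : (LatticeCell n →₀ R) →ₗ[R] (LatticeCell n →₀ R) :=
  Finsupp.linearCombination R fun c => ∑ i ∈ c.2, orient c.2 i •
    (Finsupp.single (c.1 + Pi.single i 1, c.2.erase i) 1 - Finsupp.single (c.1, c.2.erase i) 1)

/-- The prism operator of the contraction in the direction `i` onto the hyperplane `zᵢ = l`. -/
noncomputable def prism (l : ℕ) (i : Fin n) : (LatticeCell n →₀ R) →ₗ[R] (LatticeCell n →₀ R) :=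
  Finsupp.linearCombination R fun c => if i ∈ c.2 then 0 else
    orient c.2 i • ∑ r ∈ Finset.Ico l (c.1 i),
      Finsupp.single (Function.update c.1 i r, insert i c.2) 1

/-- The chain map of the projection in the direction `i` onto the hyperplane `zᵢ = l`. -/
noncomputable def collapse (l : ℕ) (i : Fin n) :
    (LatticeCell n →₀ R) →ₗ[R] (LatticeCell n →₀ R) :=
  Finsupp.linearCombination R fun c => if i ∈ c.2 then 0 else
    Finsupp.single (Function.update c.1 i l, c.2) 1

theorem bdry_single (a : Fin n → ℕ) (D : Finset (Fin n)) :
    bdry R (Finsupp.single (a, D) 1) = ∑ i ∈ D, orient D i •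
      (Finsupp.single (a + Pi.single i 1, D.erase i) 1 - Finsupp.single (a, D.erase i) 1) := by
  rw [bdry, Finsupp.linearCombination_single, one_smul]

theorem prism_single (l : ℕ) (i : Fin n) (a : Fin n → ℕ) (D : Finset (Fin n)) :
    prism R l i (Finsupp.single (a, D) 1) = if i ∈ D then 0 else
      orient D i • ∑ r ∈ Finset.Ico l (a i),
        Finsupp.single (Function.update a i r, insert i D) 1 := by
  rw [prism, Finsupp.linearCombination_single, one_smul]

theorem collapse_single (l : ℕ) (i : Fin n) (a : Fin n → ℕ) (D : Finset (Fin n)) :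
    collapse R l i (Finsupp.single (a, D) 1) = if i ∈ D then 0 else
      Finsupp.single (Function.update a i l, D) 1 := by
  rw [collapse, Finsupp.linearCombination_single, one_smul]

theorem update_add_single_self (a : Fin n → ℕ) (i : Fin n) (r : ℕ) :
    Function.update (a + Pi.single i 1) i r = Function.update a i r := by
  funext j
  by_cases h : j = i
  · subst h; simp
  · simp [h]

theorem update_add_single_of_ne (a : Fin n → ℕ) {i j : Fin n} (hij : j ≠ i) (r : ℕ) :
    Function.update (a + Pi.single j 1) i r = Function.update a i r + Pi.single j 1 := by
  funext m
  by_cases h : m = i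
  · subst h; simp [hij.symm]
  · simp [h]

/-- For a cell extending in direction `i`, the two facets in that direction project to the same cell
and cancel, and all other facets still contain `i` and are killed. For other cells the projection
acts on facets one by one. -/
theorem bdry_collapse (l : ℕ) (i : Fin n) (v : LatticeCell n →₀ R) :
    bdry R (collapse R l i v) = collapse R l i (bdry R v) := by
  suffices h : (bdry R).comp (collapse R l i) = (collapse R l i).comp (bdry R) from
    LinearMap.congr_fun h v
  refine Finsupp.lhom_ext' fun ⟨a, D⟩ => LinearMap.ext_ring ?_
  simp only [LinearMap.comp_apply, Finsupp.lsingle_apply, bdry_single, collapse_single, map_sum,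
    map_zsmul, map_sub]
  by_cases hi : i ∈ D
  · rw [if_pos hi, map_zero]
    refine (Finset.sum_eq_zero fun j hj => ?_).symm
    by_cases hji : j = i
    · subst hji
      simp [update_add_single_self]
    · simp [hi, Ne.symm hji]
  · rw [if_neg hi, bdry_single]
    refine Finset.sum_congr rfl fun j hj => ?_
    have hji : j ≠ i := fun h => hi (h ▸ hj)
    simp [hi, update_add_single_of_ne a hji]

/-- If `i ∈ D`, only the two facets in direction `i` have prisms, and these differ by one layer, the
cell itself. If `i ∉ D`, the end walls of the prism telescope to the cell minus its projection, and
the lateral walls cancel the prisms over the facets. -/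
theorem bdry_prism_single {l : ℕ} {i : Fin n} {a : Fin n → ℕ} (ha : l ≤ a i)
    (D : Finset (Fin n)) :
    bdry R (prism R l i (Finsupp.single (a, D) 1)) +
        prism R l i (bdry R (Finsupp.single (a, D) 1)) =
      Finsupp.single (a, D) 1 - collapse R l i (Finsupp.single (a, D) 1) := by
  by_cases hi : i ∈ D
  · rw [prism_single, if_pos hi, map_zero, zero_add, collapse_single, if_pos hi, sub_zero,
      bdry_single, map_sum, Finset.sum_eq_single_of_mem i hi]
    · simp only [map_zsmul, map_sub, prism_single, Finset.notMem_erase, if_false,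
        orient_erase_self, Finset.insert_erase hi,
        update_add_single_self, Pi.add_apply, Pi.single_eq_same, Finset.sum_Ico_succ_top ha,
        Function.update_eq_self]
      rw [← zsmul_sub, smul_smul, orient_mul_self, one_smul, add_sub_cancel_left]
    · intro j _ hji
      simp [prism_single, hi, Ne.symm hji]
  · rw [prism_single, if_neg hi, collapse_single, if_neg hi, bdry_single]
    simp only [map_zsmul, map_sum, bdry_single, Finset.sum_insert hi, orient_insert_self,
      Finset.sum_add_distrib, Finset.erase_insert hi, smul_add]
    -- The walls orthogonal to direction `i`: consecutive layers share a wall, so only the walls at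
    -- `a i` and at `l` survive.
    have h1 : ∑ r ∈ Finset.Ico l (a i), orient D i •
        (Finsupp.single (Function.update a i r + Pi.single i 1, D) (1 : R) -
          Finsupp.single (Function.update a i r, D) 1) =
        orient D i • (Finsupp.single (a, D) 1 - Finsupp.single (Function.update a i l, D) 1) := by
      rw [← Finset.smul_sum]
      congr 1
      have := Finset.sum_Ico_sub
        (fun r => (Finsupp.single (Function.update a i r, D) (1 : R) : LatticeCell n →₀ R)) ha
      rw [Function.update_eq_self] at this
      rw [← this]
      refine Finset.sum_congr rfl fun r _ => ?_
      congr 3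
      funext j
      by_cases h : j = i
      · subst h; simp
      · simp [h]
    -- The walls orthogonal to direction `i` already give the right-hand side; what is left are the
    -- lateral terms, which have to cancel for each facet direction `j`.
    rw [h1, smul_smul, orient_mul_self, one_smul, add_assoc, add_eq_left, Finset.sum_comm,
      Finset.smul_sum, ← Finset.sum_add_distrib]
    refine Finset.sum_eq_zero fun j hj => ?_
    have hji : j ≠ i := fun h => hi (h ▸ hj)
    have hi' : i ∉ D.erase j := fun h => hi (Finset.mem_of_mem_erase h)
    rw [← Finset.smul_sum, smul_smul, map_sub, prism_single, prism_single, if_neg hi', if_neg hi',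
      ← zsmul_sub, smul_smul, orient_mul_orient_erase hi hj, Pi.add_apply,
      Pi.single_eq_of_ne hji.symm, add_zero, ← Finset.sum_sub_distrib, neg_smul,
      Finset.erase_insert_of_ne hji.symm]
    simp only [update_add_single_of_ne a hji]
    rw [add_neg_cancel]

/-! ### Acyclicity of boxes -/

/-- The cell lies in the box with the corners `l` and `u`. -/
def InBox (l u : Fin n → ℕ) (c : LatticeCell n) : Prop :=
  ∀ i, l i ≤ c.1 i ∧ c.1 i + (if i ∈ c.2 then 1 else 0) ≤ u i

theorem InBox.update {l u a : Fin n → ℕ} {D : Finset (Fin n)} (h : InBox l u (a, D)) (i : Fin n) :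
    InBox l u (Function.update a i (l i), D) := by
  intro j
  have hj := h j
  by_cases hji : j = i
  · subst hji
    simp only [Function.update_self] at hj ⊢
    omega
  · simpa [hji] using hj

theorem InBox.update_insert {l u a : Fin n → ℕ} {D : Finset (Fin n)} (h : InBox l u (a, D))
    {i : Fin n} {r : ℕ} (hr : r ∈ Finset.Ico (l i) (a i)) :
    InBox l u (Function.update a i r, insert i D) := by
  intro j
  have hj := h j
  rw [Finset.mem_Ico] at hr
  by_cases hji : j = i
  · subst hji
    simp only [Function.update_self, Finset.mem_insert, true_or, if_true] at hj ⊢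
    omega
  · simpa [hji] using hj

theorem map_mem_of_mem_supported {ι M : Type*} [AddCommGroup M] [Module R M] {s : Set ι}
    {f : (ι →₀ R) →ₗ[R] M} {N : Submodule R M} (h : ∀ c ∈ s, f (Finsupp.single c 1) ∈ N)
    {v : ι →₀ R} (hv : v ∈ Finsupp.supported R R s) : f v ∈ N := by
  rw [Finsupp.supported_eq_span_single] at hv
  have : Submodule.span R ((fun i => Finsupp.single i (1 : R)) '' s) ≤ N.comap f :=
    Submodule.span_le.2 (by rintro _ ⟨c, hc, rfl⟩; exact h c hc)
  exact this hv

/-- The box supplies `l i ≤ a i`. Below the hyperplane the interval `Ico` would be empty and the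
homotopy formula would fail. -/
theorem bdry_prism {l u : Fin n → ℕ} (i : Fin n) {v : LatticeCell n →₀ R}
    (hv : v ∈ Finsupp.supported R R {c | InBox l u c}) :
    bdry R (prism R (l i) i v) + prism R (l i) i (bdry R v) = v - collapse R (l i) i v := by
  have := map_mem_of_mem_supported R (s := {c | InBox l u c}) (N := ⊥)
    (f := (bdry R).comp (prism R (l i) i) + (prism R (l i) i).comp (bdry R) -
      (LinearMap.id - collapse R (l i) i)) (fun ⟨a, D⟩ hc => ?_) hv
  · simpa [sub_eq_zero] using this
  · simpa [sub_eq_zero] using bdry_prism_single R (hc i).1 D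

/-- A cycle in a box is homologous to a cycle in the corner of the box. -/
theorem exists_eq_bdry_add {l u : Fin n → ℕ} {d : ℕ} {w : LatticeCell n →₀ R}
    (hw : w ∈ Finsupp.supported R R {c | InBox l u c ∧ c.2.card = d}) (hb : bdry R w = 0)
    (T : Finset (Fin n)) :
    ∃ v ∈ Finsupp.supported R R {c : LatticeCell n | InBox l u c ∧ c.2.card = d + 1},
      ∃ w' ∈ Finsupp.supported R R
        {c : LatticeCell n | (InBox l u c ∧ c.2.card = d) ∧ ∀ i ∈ T, i ∉ c.2 ∧ c.1 i = l i},
        bdry R w' = 0 ∧ w = bdry R v + w' := by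
  induction T using Finset.induction_on with
  | empty => exact ⟨0, zero_mem _, w, by simpa using hw, hb, by simp⟩
  | insert i T hi ih =>
    obtain ⟨v, hv, w', hw', hb', rfl⟩ := ih
    -- Since `w'` is a cycle, the homotopy formula reads: the boundary of the prism over `w'` is
    -- `w'` minus its projection. The projection flattens direction `i` and keeps the directions of
    -- `T` flat.
    have h := bdry_prism R (l := l) (u := u) i
      (Finsupp.supported_mono (fun c hc => hc.1.1) hw')
    rw [hb', map_zero, add_zero] at h
    refine ⟨v + prism R (l i) i w', add_mem hv ?_, collapse R (l i) i w', ?_, ?_, ?_⟩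
    · refine map_mem_of_mem_supported R (fun ⟨a, D⟩ hc => ?_) hw'
      rw [prism_single]
      split_ifs with hD
      · exact zero_mem _
      · refine Submodule.smul_of_tower_mem _ _ (sum_mem fun r hr => ?_)
        refine Finsupp.single_mem_supported R _ ⟨hc.1.1.update_insert hr, ?_⟩
        rw [Finset.card_insert_of_notMem hD, hc.1.2]
    · refine map_mem_of_mem_supported R (fun ⟨a, D⟩ hc => ?_) hw'
      rw [collapse_single]
      split_ifs with hD
      · exact zero_mem _
      · refine Finsupp.single_mem_supported R _ ⟨⟨hc.1.1.update i, hc.1.2⟩, fun j hj => ?_⟩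
        by_cases hji : j = i
        · subst hji
          exact ⟨hD, by simp⟩
        · have := hc.2 j ((Finset.mem_insert.1 hj).resolve_left hji)
          simpa [hji] using this
    · rw [bdry_collapse, hb', map_zero]
    · rw [map_add, h]
      abel

/-- A cycle in a box is, up to a boundary, a multiple of the corner of the box. -/
theorem exists_eq_bdry_add_single {l u : Fin n → ℕ} {d : ℕ} {w : LatticeCell n →₀ R}
    (hw : w ∈ Finsupp.supported R R {c | InBox l u c ∧ c.2.card = d}) (hb : bdry R w = 0) :
    ∃ v ∈ Finsupp.supported R R {c : LatticeCell n | InBox l u c ∧ c.2.card = d + 1},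
      ∃ r : R, w = bdry R v + Finsupp.single (l, ∅) r ∧ (d ≠ 0 → r = 0) := by
  obtain ⟨v, hv, w', hw', -, h⟩ := exists_eq_bdry_add R hw hb Finset.univ
  -- After flattening all directions the only cell left is the vertex `l`, which has dimension `0`.
  have hsupp : ∀ c, w' c ≠ 0 → c = (l, ∅) ∧ d = 0 := by
    rintro ⟨a, D⟩ hc
    obtain ⟨⟨-, hd⟩, hc⟩ := hw' (Finsupp.mem_support_iff.2 hc)
    obtain rfl : D = ∅ := Finset.eq_empty_of_forall_notMem fun i => (hc i (Finset.mem_univ i)).1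
    exact ⟨Prod.ext (funext fun i => (hc i (Finset.mem_univ i)).2) rfl, by simpa using hd.symm⟩
  refine ⟨v, hv, w' (l, ∅), ?_, fun hd => ?_⟩
  · rw [h]
    congr 1
    ext c
    by_cases hc : c = (l, ∅)
    · simp [hc]
    · rw [Finsupp.single_eq_of_ne hc]
      by_contra h0
      exact hc (hsupp c h0).1
  · by_contra h0
    exact hd (hsupp _ h0).2

/-- The sum of the coefficients of a boundary of edges is zero. -/
theorem sum_bdry_eq_zero {v : LatticeCell n →₀ R} :
    Finsupp.linearCombination R (fun _ : LatticeCell n => (1 : R)) (bdry R v) = 0 := by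
  suffices h : (Finsupp.linearCombination R (fun _ : LatticeCell n => (1 : R))).comp (bdry R) = 0
    from LinearMap.congr_fun h v
  refine Finsupp.lhom_ext' fun ⟨a, D⟩ => LinearMap.ext_ring ?_
  simp only [LinearMap.comp_apply, Finsupp.lsingle_apply, bdry_single, map_sum, map_zsmul, map_sub,
    Finsupp.linearCombination_single, sub_self, smul_zero, Finset.sum_const_zero,
    LinearMap.zero_apply]

end LatticeCell

/-! ### The criterion of Bayer and Sturmfels -/

namespace LabelledCellComplex

variable {σ : Type} (X : LabelledCellComplex σ)

theorem label_le_label {i : ℕ} {F : X.Face (i + 1)} {G : X.Face i} (h : X.faceSign F G ≠ 0) :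
    X.label G ≤ X.label F := by
  cases i with
  | zero => exact bot_le
  | succ i =>
    have hsub : X.closedCell (d := i) G ⊆ X.closedCell (d := i + 1) F := by
      by_contra hn
      exact h (X.sign_eq_zero F G hn)
    classical
    change X.cellLabel (d := i) G ≤ X.cellLabel (d := i + 1) F
    refine Finset.sup_mono fun v hv => ?_
    rw [Finset.mem_filter] at hv ⊢
    exact ⟨hv.1, hv.2.trans hsub⟩

theorem sum_faceSign_mul_faceSign {i : ℕ} (F : X.Face (i + 2)) (H : X.Face i) :
    ∑ G, X.faceSign F G * X.faceSign G H = 0 := by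
  cases i with
  | zero =>
    refine Eq.trans ?_ (X.sum_sign_edge F)
    exact Finset.sum_congr rfl fun G _ => mul_one _
  | succ i => exact X.sum_sign_mul_sign F H

variable (k : Type*) [Field k]

theorem diff_apply (i : ℕ) (v : X.Mod k (i + 1)) (G : X.Face i) :
    X.diff k i v G = ∑ F, v F *
      MvPolynomial.monomial (X.label F - X.label G) (X.faceSign F G : k) := by
  classical
  rw [diff, Finsupp.linearCombination_apply, Finsupp.sum_fintype _ _ (by simp),
    Finsupp.finsetSum_apply]
  refine Finset.sum_congr rfl fun F _ => ?_
  rw [Finsupp.smul_apply, Finsupp.finsetSum_apply, smul_eq_mul,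
    Finset.sum_eq_single_of_mem G (Finset.mem_univ G)]
  · rw [Finsupp.single_eq_same]
  · intro H _ hH
    rw [Finsupp.single_eq_of_ne hH.symm]

/-- The exponents telescope: `(b - a_F) + (a_F - a_G) = b - a_G`. With truncated subtraction this
needs `a_G ≤ a_F ≤ b`; where one of these may fail, a coefficient is zero and so are both sides. -/
theorem monomial_mul_monomial_faceSign {i : ℕ} (F : X.Face (i + 1)) (G : X.Face i) {b : σ →₀ ℕ}
    {r : k} (hr : r ≠ 0 → X.label F ≤ b) :
    MvPolynomial.monomial (b - X.label F) r *
        MvPolynomial.monomial (X.label F - X.label G) (X.faceSign F G : k) =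
      MvPolynomial.monomial (b - X.label G) (r * (X.faceSign F G : k)) := by
  by_cases h0 : r = 0
  · simp [h0]
  by_cases h1 : X.faceSign F G = 0
  · simp [h1]
  rw [MvPolynomial.monomial_mul, tsub_add_tsub_cancel (hr h0) (X.label_le_label h1)]

theorem diff_diff (i : ℕ) (v : X.Mod k (i + 2)) : X.diff k i (X.diff k (i + 1) v) = 0 := by
  ext1 H
  simp only [diff_apply, Finset.sum_mul, mul_assoc]
  rw [Finset.sum_comm]
  refine Finset.sum_eq_zero fun F _ => ?_
  rw [← Finset.mul_sum]
  have : ∀ G : X.Face (i + 1), MvPolynomial.monomial (X.label F - X.label G) (X.faceSign F G : k) *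
      MvPolynomial.monomial (X.label G - X.label H) (X.faceSign G H : k) =
      MvPolynomial.monomial (X.label F - X.label H) (X.faceSign F G * X.faceSign G H : k) :=
    fun G => X.monomial_mul_monomial_faceSign k G H fun h =>
      X.label_le_label fun h' => h (by simp [h'])
  simp only [this]
  rw [← map_sum]
  have h := X.sum_faceSign_mul_faceSign F H
  have h' : ∑ G, (X.faceSign F G * X.faceSign G H : k) = 0 := by
    exact_mod_cast congrArg (Int.cast (R := k)) h
  rw [h', map_zero, mul_zero]

/-- The cellular complex is exact if the subcomplexes of the cells whose labels divide a given
monomial are acyclic. -/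
theorem exact_diff_of_acyclic (i : ℕ)
    (hX : ∀ (b : σ →₀ ℕ) (w : X.Face (i + 1) → k), (∀ F, w F ≠ 0 → X.label F ≤ b) →
      (∀ G, ∑ F, w F * (X.faceSign F G : k) = 0) →
      ∃ u : X.Face (i + 2) → k, (∀ F, u F ≠ 0 → X.label F ≤ b) ∧
        ∀ G, ∑ F, u F * (X.faceSign F G : k) = w G) :
    Function.Exact (X.diff k (i + 1)) (X.diff k i) := by
  classical
  intro v
  refine ⟨fun hv => ?_, ?_⟩
  swap
  · rintro ⟨u, rfl⟩
    exact X.diff_diff k i u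
  -- The strand of `v` in multidegree `b`: the basis element of `F` has degree `X.label F`, so its
  -- coefficient contributes the monomial of exponent `b - X.label F`.
  let w : (σ →₀ ℕ) → X.Face (i + 1) → k := fun b F =>
    if X.label F ≤ b then (v F).coeff (b - X.label F) else 0
  have hw : ∀ b F, w b F ≠ 0 → X.label F ≤ b := fun b F h => by
    by_contra hn
    exact h (if_neg hn)
  have hcycle : ∀ b G, ∑ F, w b F * (X.faceSign F G : k) = 0 := by
    intro b G
    by_cases hG : X.label G ≤ b
    · have h := congrArg (MvPolynomial.coeff (b - X.label G)) (DFunLike.congr_fun hv G)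
      rw [diff_apply, MvPolynomial.coeff_sum, Finsupp.zero_apply, MvPolynomial.coeff_zero] at h
      rw [← h]
      refine Finset.sum_congr rfl fun F _ => ?_
      by_cases h1 : X.faceSign F G = 0
      · simp [h1]
      have h2 := X.label_le_label h1
      have h3 : X.label F - X.label G ≤ b - X.label G ↔ X.label F ≤ b := by
        rw [tsub_le_iff_right, tsub_add_cancel_of_le hG]
      simp only [w, MvPolynomial.coeff_mul_monomial', h3]
      split_ifs with h3
      · rw [tsub_tsub_tsub_cancel_right h2]
      · rw [zero_mul]
    · refine Finset.sum_eq_zero fun F _ => ?_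
      by_cases h1 : X.faceSign F G = 0
      · simp [h1]
      · rw [show w b F = 0 from if_neg fun h => hG ((X.label_le_label h1).trans h), zero_mul]
  choose u hu hu' using fun b => hX b (w b) (hw b) (hcycle b)
  -- The finitely many multidegrees in which `v` has a nonzero strand. The preimage of `v` is put
  -- together from the chains bounding these strands.
  let B : Finset (σ →₀ ℕ) := Finset.univ.biUnion fun F => (v F).support.image (· + X.label F)
  refine ⟨∑ b ∈ B, ∑ F, Finsupp.single F (MvPolynomial.monomial (b - X.label F) (u b F)), ?_⟩
  have happ : ∀ F, (∑ b ∈ B, ∑ F, Finsupp.single F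
      (MvPolynomial.monomial (b - X.label F) (u b F)) : X.Mod k (i + 2)) F =
      ∑ b ∈ B, MvPolynomial.monomial (b - X.label F) (u b F) := by
    intro F
    rw [Finsupp.finsetSum_apply]
    refine Finset.sum_congr rfl fun b _ => ?_
    rw [Finsupp.finsetSum_apply, Finset.sum_eq_single_of_mem F (Finset.mem_univ F)]
    · rw [Finsupp.single_eq_same]
    · intro H _ hH
      rw [Finsupp.single_eq_of_ne hH.symm]
  ext1 G
  rw [diff_apply]
  simp only [happ, Finset.sum_mul]
  rw [Finset.sum_comm]
  have hb : ∀ b ∈ B, ∑ F, MvPolynomial.monomial (b - X.label F) (u b F) *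
      MvPolynomial.monomial (X.label F - X.label G) (X.faceSign F G : k) =
      MvPolynomial.monomial (b - X.label G) (w b G) := by
    intro b _
    rw [← hu' b G, map_sum]
    exact Finset.sum_congr rfl fun F _ => X.monomial_mul_monomial_faceSign k F G (hu b F)
  rw [Finset.sum_congr rfl hb]
  ext m
  rw [MvPolynomial.coeff_sum]
  have hm : w (m + X.label G) G = (v G).coeff m := by
    simp only [w]
    rw [if_pos le_add_self, add_tsub_cancel_right]
  -- At `G`, the monomial `m` comes only from the strand of degree `m + X.label G`. Truncated
  -- subtraction could also produce `m` from other `b`, but there `w b G` is zero.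
  rw [Finset.sum_eq_single (m + X.label G)]
  · rw [MvPolynomial.coeff_monomial, if_pos (add_tsub_cancel_right _ _), hm]
  · intro b _ hne
    rw [MvPolynomial.coeff_monomial]
    split_ifs with h
    · by_contra h0
      exact hne (by rw [← h, tsub_add_cancel_of_le (hw b G h0)])
    · rfl
  · intro hB
    rw [MvPolynomial.coeff_monomial, if_pos (add_tsub_cancel_right _ _), hm]
    by_contra h0
    refine hB (Finset.mem_biUnion.2 ⟨G, Finset.mem_univ G, Finset.mem_image.2 ⟨m, ?_, rfl⟩⟩)
    exact MvPolynomial.mem_support_iff.2 h0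

end LabelledCellComplex

/-! ### The labels of the subdivided cubes -/

/-- The exponent vector of `∏ i, x_{P (i, 0)} ^ f i * x_{P (i, 1)} ^ g i`. -/
noncomputable def pairExponent {n : ℕ} (P : Fin n × Fin 2 ≃ Fin (2 * n)) (f g : Fin n → ℕ) :
    Fin (2 * n) →₀ ℕ :=
  ∑ i, (Finsupp.single (P (i, 0)) (f i) + Finsupp.single (P (i, 1)) (g i))

section

variable {n p d : ℕ} (P : Fin n × Fin 2 ≃ Fin (2 * n))

theorem pairExponent_apply_zero (f g : Fin n → ℕ) (i : Fin n) :
    pairExponent P f g (P (i, 0)) = f i := by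
  simp [pairExponent, Finsupp.finsetSum_apply, Finsupp.single_apply]

theorem pairExponent_apply_one (f g : Fin n → ℕ) (i : Fin n) :
    pairExponent P f g (P (i, 1)) = g i := by
  simp [pairExponent, Finsupp.finsetSum_apply, Finsupp.single_apply]

theorem forall_variable_iff {p : Fin (2 * n) → Prop} :
    (∀ j, p j) ↔ ∀ i, p (P (i, 0)) ∧ p (P (i, 1)) := by
  rw [← P.forall_congr_right]
  simp [Prod.forall, Fin.forall_fin_two]

theorem pairExponent_le_iff {f g : Fin n → ℕ} {b : Fin (2 * n) →₀ ℕ} :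
    pairExponent P f g ≤ b ↔ ∀ i, f i ≤ b (P (i, 0)) ∧ g i ≤ b (P (i, 1)) := by
  rw [Finsupp.le_def, forall_variable_iff P]
  simp only [pairExponent_apply_zero, pairExponent_apply_one]

theorem pairExponent_add (f g f' g' : Fin n → ℕ) :
    pairExponent P f g + pairExponent P f' g' = pairExponent P (f + f') (g + g') := by
  ext j
  revert j
  rw [forall_variable_iff P]
  simp only [Finsupp.add_apply, pairExponent_apply_zero, pairExponent_apply_one, Pi.add_apply,
    and_self, implies_true]

theorem monomial_pairExponent (k : Type*) [Field k] (f g : Fin n → ℕ) :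
    (MvPolynomial.monomial (pairExponent P f g) 1 : MvPolynomial (Fin (2 * n)) k) =
      ∏ i, (MvPolynomial.X (P (i, 0)) ^ f i * MvPolynomial.X (P (i, 1)) ^ g i) := by
  rw [pairExponent, MvPolynomial.monomial_sum_one]
  simp only [MvPolynomial.X_pow_eq_monomial, MvPolynomial.monomial_mul, one_mul]

theorem closedCell_subdividedCube (F : CubeCell n p d) :
    ((subdividedCube P p).closedCell (d := d) F : Set (Fin n → ℝ)) = Icc F.lo F.hi :=
  F.charFun_image_closedBall

theorem CubeCell.vertex_subset_iff (v : CubeCell n p 0) (F : CubeCell n p d) :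
    Icc v.lo v.hi ⊆ Icc F.lo F.hi ↔
      ∀ i, F.base i ≤ v.base i ∧ v.base i ≤ F.base i + if i ∈ F.dirs then 1 else 0 := by
  have hv : v.dirs = ∅ := Finset.card_eq_zero.1 v.card_dirs
  rw [Icc_subset_Icc_iff v.lo_le_hi, Pi.le_def, Pi.le_def, ← forall_and]
  refine forall_congr' fun i => ?_
  simp only [CubeCell.lo, CubeCell.hi, hv, Finset.notMem_empty, if_false, add_zero]
  split_ifs <;> norm_cast

/-- On the vertices of a cell the `y`-exponents `p - a_i` are largest at the lowest corner and the
`z`-exponents `a_i` at the highest one, so these two corners determine the least common multiple. -/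
theorem cellLabel_subdividedCube (F : CubeCell n p d) :
    (subdividedCube P p).cellLabel (d := d) F = pairExponent P (fun i => p - F.base i)
      (fun i => F.base i + if i ∈ F.dirs then 1 else 0) := by
  classical
  have hmem : ∀ v : CubeCell n p 0, ((subdividedCube P p).closedCell (d := 0) v ⊆
      (subdividedCube P p).closedCell (d := d) F) ↔ ∀ i, F.base i ≤ v.base i ∧
        v.base i ≤ F.base i + if i ∈ F.dirs then 1 else 0 := fun v => by
    rw [← v.vertex_subset_iff F, ← closedCell_subdividedCube P, ← closedCell_subdividedCube P]
    rfl
  have hle : ∀ v : CubeCell n p 0, ((subdividedCube P p).closedCell (d := 0) v ⊆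
      (subdividedCube P p).closedCell (d := d) F) →
      pairExponent P (fun i => p - v.base i) v.base ≤ (subdividedCube P p).cellLabel (d := d) F :=
    fun v hv => Finset.le_sup (f := (subdividedCube P p).vertexLabel)
      (Finset.mem_filter.2 ⟨Finset.mem_univ _, hv⟩)
  apply le_antisymm
  · refine Finset.sup_le fun v hv => ?_
    have hv := (hmem v).1 (Finset.mem_filter.1 hv).2
    refine (pairExponent_le_iff P).2 fun i => ?_
    rw [pairExponent_apply_zero, pairExponent_apply_one]
    have := hv i
    exact ⟨by omega, this.2⟩
  · have h0 := (pairExponent_le_iff P).1 (hle (CubeCell.mk F.base ∅ F.base_le Finset.card_empty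
      (by simp)) ((hmem _).2 fun i => by rw [CubeCell.base_mk]; simp))
    have h1 := (pairExponent_le_iff P).1 (hle (CubeCell.mk
      (fun i => F.base i + if i ∈ F.dirs then 1 else 0) ∅ (fun i => by
        split_ifs with hi
        · exact F.base_lt hi
        · exact F.base_le i) Finset.card_empty (by simp))
      ((hmem _).2 fun i => by rw [CubeCell.base_mk]; simp))
    exact (pairExponent_le_iff P).2 fun i => ⟨(h0 i).1, (h1 i).2⟩

/-- Divisibility bounds the lowest corner from below through the `y`-exponents and the highest
corner from above through the `z`-exponents. The minimum with `p` costs nothing, because cells lie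
in the cube, and it keeps the box inside the cube. -/
theorem cellLabel_subdividedCube_le_iff (F : CubeCell n p d) (b : Fin (2 * n) →₀ ℕ) :
    (subdividedCube P p).cellLabel (d := d) F ≤ b ↔ LatticeCell.InBox (fun i => p - b (P (i, 0)))
      (fun i => min p (b (P (i, 1)))) (F.base, F.dirs) := by
  rw [cellLabel_subdividedCube, pairExponent_le_iff]
  refine forall_congr' fun i => ?_
  have h : F.base i + (if i ∈ F.dirs then 1 else 0) ≤ p := by
    split_ifs with hi
    · exact F.base_lt hi
    · exact F.base_le i
  simp only [le_min_iff]
  omega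

end

/-! ### The cellular chains of a subdivided cube as lattice chains -/

namespace CubeCell

variable {n p d : ℕ} (R : Type*) [CommRing R]

theorem sum_sign_smul {M : Type*} [AddCommGroup M] (F : CubeCell n p (d + 1))
    (h : CubeCell n p d → M) :
    ∑ G, F.sign G • h G = ∑ i : F.dirs, LatticeCell.orient F.dirs i.1 •
      (h (F.facet i.1 i.2 1 le_rfl) - h (F.facet i.1 i.2 0 zero_le_one)) := by
  have key : ∀ (i : F.dirs) (ε : ℕ) (hε : ε ≤ 1),
      ∑ G, (if F.IsFacet i.1 ε G then (1 : ℤ) else 0) • h G = h (F.facet i.1 i.2 ε hε) := by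
    intro i ε hε
    rw [Finset.sum_eq_single (F.facet i.1 i.2 ε hε)]
    · rw [if_pos (isFacet_iff.2 rfl), one_smul]
    · intro G _ hG
      rw [if_neg fun h' => hG (isFacet_iff.1 h'), zero_smul]
    · simp
  simp only [sign, Finset.sum_smul]
  rw [Finset.sum_comm, ← Finset.sum_coe_sort]
  refine Finset.sum_congr rfl fun i _ => ?_
  rw [← key i 1 le_rfl, ← key i 0 zero_le_one, ← Finset.sum_sub_distrib, Finset.smul_sum]
  refine Finset.sum_congr rfl fun G _ => ?_
  rw [mul_smul, sub_smul]
  rfl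

/-- A chain of a subdivided cube as a chain of the lattice. -/
noncomputable def latticeChain (w : CubeCell n p d → R) : LatticeCell n →₀ R :=
  ∑ F, Finsupp.single (F.base, F.dirs) (w F)

variable {R} in
theorem latticeChain_apply (w : CubeCell n p d → R) (F : CubeCell n p d) :
    latticeChain R w (F.base, F.dirs) = w F := by
  classical
  rw [latticeChain, Finsupp.finsetSum_apply, Finset.sum_eq_single_of_mem F (Finset.mem_univ F)]
  · rw [Finsupp.single_eq_same]
  · intro G _ hG
    rw [Finsupp.single_eq_of_ne]
    intro h
    exact hG (ext' (Prod.ext_iff.1 h).1 (Prod.ext_iff.1 h).2).symm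

theorem latticeChain_mem_supported (w : CubeCell n p d → R) {s : Set (LatticeCell n)}
    (hw : ∀ F, w F ≠ 0 → (F.base, F.dirs) ∈ s) :
    latticeChain R w ∈ Finsupp.supported R R s := by
  refine sum_mem fun F _ => ?_
  by_cases h : w F = 0
  · rw [h, Finsupp.single_zero]
    exact zero_mem _
  · exact Finsupp.single_mem_supported R _ (hw F h)

theorem exists_latticeChain_eq {v : LatticeCell n →₀ R}
    (hv : v ∈ Finsupp.supported R R
      {c : LatticeCell n | (∀ i, c.1 i + (if i ∈ c.2 then 1 else 0) ≤ p) ∧ c.2.card = d}) :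
    ∃ u : CubeCell n p d → R, latticeChain R u = v := by
  refine ⟨fun F => v (F.base, F.dirs), ?_⟩
  ext ⟨a, D⟩
  by_cases h : (∀ i, a i + (if i ∈ D then 1 else 0) ≤ p) ∧ D.card = d
  · exact latticeChain_apply (fun F : CubeCell n p d => v (F.base, F.dirs))
      (mk a D (fun i => (Nat.le_add_right _ _).trans (h.1 i)) h.2
        fun i hi => by have := h.1 i; rwa [if_pos hi] at this)
  · rw [(Finsupp.mem_supported' R v).1 hv _ h]
    refine (Finsupp.mem_supported' R _).1 (latticeChain_mem_supported R (s := {c | (∀ i,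
      c.1 i + (if i ∈ c.2 then 1 else 0) ≤ p) ∧ c.2.card = d}) _ fun F _ => ?_) _ h
    refine ⟨fun i => ?_, F.card_dirs⟩
    dsimp only
    split_ifs with hi
    · exact F.base_lt hi
    · exact F.base_le i

/-- This transfers the homotopy argument to the cube: lattice chains have all dimensions in one
module and no bound `p`, so prisms can be formed freely. -/
theorem bdry_latticeChain (w : CubeCell n p (d + 1) → R) :
    LatticeCell.bdry R (latticeChain R w) =
      latticeChain R fun G => ∑ F, w F * (F.sign G : R) := by
  have hF : ∀ F : CubeCell n p (d + 1), LatticeCell.bdry R (Finsupp.single (F.base, F.dirs) 1) =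
      ∑ G : CubeCell n p d, F.sign G • Finsupp.single (G.base, G.dirs) 1 := by
    intro F
    rw [LatticeCell.bdry_single, sum_sign_smul F (fun G => Finsupp.single (G.base, G.dirs) 1),
      ← Finset.sum_coe_sort]
    refine Finset.sum_congr rfl fun i _ => ?_
    simp only [facet, base_mk, dirs_mk, Pi.single_zero, add_zero]
  simp only [latticeChain, map_sum]
  have hF' : ∀ F : CubeCell n p (d + 1),
      LatticeCell.bdry R (Finsupp.single (F.base, F.dirs) (w F)) =
        ∑ G : CubeCell n p d, Finsupp.single (G.base, G.dirs) (w F * (F.sign G : R)) := by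
    intro F
    rw [← mul_one (w F), ← smul_eq_mul, ← Finsupp.smul_single, map_smul, hF, Finset.smul_sum]
    refine Finset.sum_congr rfl fun G _ => ?_
    rw [← Int.cast_smul_eq_zsmul R, Finsupp.smul_single, Finsupp.smul_single]
    simp
  simp only [hF']
  rw [Finset.sum_comm]
  refine Finset.sum_congr rfl fun G _ => ?_
  rw [← Finsupp.single_finsetSum]

/-- A cycle of a box in a subdivided cube bounds a chain of the box. In dimension `0` the cycles
are those of the augmented complex. -/
theorem exists_bdry_eq {l u : Fin n → ℕ} (hu : ∀ i, u i ≤ p) {w : CubeCell n p d → R}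
    (hw : ∀ F, w F ≠ 0 → LatticeCell.InBox l u (F.base, F.dirs))
    (hb : LatticeCell.bdry R (latticeChain R w) = 0) (h0 : d = 0 → ∑ F, w F = 0) :
    ∃ v : CubeCell n p (d + 1) → R, (∀ F, v F ≠ 0 → LatticeCell.InBox l u (F.base, F.dirs)) ∧
      ∀ G, ∑ F, v F * (F.sign G : R) = w G := by
  obtain ⟨v, hv, r, h, hr⟩ := LatticeCell.exists_eq_bdry_add_single R (l := l) (u := u) (d := d)
    (latticeChain_mem_supported R w fun F hF => ⟨hw F hF, F.card_dirs⟩) hb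
  -- In dimension `0` the sum of coefficients kills boundaries, so `r` is the sum of the
  -- coefficients of `w`, which vanishes by `h0`.
  have hr : r = 0 := by
    by_cases hd : d = 0
    · have h' := congrArg (Finsupp.linearCombination R fun _ : LatticeCell n => (1 : R)) h
      rw [map_add, LatticeCell.sum_bdry_eq_zero, zero_add, Finsupp.linearCombination_single,
        smul_eq_mul, mul_one, latticeChain, map_sum] at h'
      simp only [Finsupp.linearCombination_single, smul_eq_mul, mul_one] at h'
      rw [← h', h0 hd]
    · exact hr hd
  rw [hr, Finsupp.single_zero, add_zero] at h
  have hsub : {c : LatticeCell n | LatticeCell.InBox l u c ∧ c.2.card = d + 1} ⊆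
      {c | (∀ i, c.1 i + (if i ∈ c.2 then 1 else 0) ≤ p) ∧ c.2.card = d + 1} :=
    fun c hc => ⟨fun i => (hc.1 i).2.trans (hu i), hc.2⟩
  obtain ⟨v', rfl⟩ := exists_latticeChain_eq R (Finsupp.supported_mono hsub hv)
  refine ⟨v', fun F hF => ?_, fun G => ?_⟩
  · rw [← latticeChain_apply v' F] at hF
    exact (hv (Finsupp.mem_support_iff.2 hF)).1
  · have := DFunLike.congr_fun h (G.base, G.dirs)
    rw [bdry_latticeChain, latticeChain_apply, latticeChain_apply] at this
    exact this.symm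

end CubeCell

/-- The cellular complex of a subdivided cube has no homology in positive degrees. -/
theorem exact_diff_subdividedCube (k : Type*) [Field k] {n : ℕ} (P : Fin n × Fin 2 ≃ Fin (2 * n))
    (p i : ℕ) :
    Function.Exact ((subdividedCube P p).diff k (i + 1)) ((subdividedCube P p).diff k i) := by
  refine (subdividedCube P p).exact_diff_of_acyclic k i fun b w hw hcycle => ?_
  obtain ⟨v, hv, hv'⟩ := CubeCell.exists_bdry_eq (d := i) k (l := fun i => p - b (P (i, 0)))
    (u := fun i => min p (b (P (i, 1)))) (fun i => min_le_left _ _) (w := w)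
    (fun F hF => (cellLabel_subdividedCube_le_iff P F b).1 (hw F hF)) (by
      -- The index `i` counts faces from the empty one, so `i = 0` is the case of vertices: their
      -- lattice boundary is zero, and the cycle condition at the empty face is the vanishing of the
      -- coefficient sum used below.
      cases i with
      | zero =>
        simp only [CubeCell.latticeChain, map_sum]
        refine Finset.sum_eq_zero fun F _ => ?_
        rw [LatticeCell.bdry, Finsupp.linearCombination_single,
          Finset.card_eq_zero.1 F.card_dirs, Finset.sum_empty, smul_zero]
      | succ d =>
        refine (CubeCell.bdry_latticeChain k (d := d) w).trans ?_
        refine Finset.sum_eq_zero fun G _ => ?_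
        exact (congrArg _ (hcycle G)).trans (Finsupp.single_zero _)) (by
      rintro rfl
      refine Eq.trans (Finset.sum_congr rfl fun F _ => ?_) (hcycle ())
      rw [show (subdividedCube P p).faceSign (i := 0) F () = 1 from rfl, Int.cast_one, mul_one])
  exact ⟨v, fun F hF => (cellLabel_subdividedCube_le_iff P F b).2 (hv F hF), hv'⟩

/-! ### Translations of subdivided cubes -/

namespace CubeCell

variable {n q p d : ℕ} {s : Fin n → ℕ}

/-- The translate of a cell of `[0, q]^n` by `s`, as a cell of `[0, p]^n`. -/
def translate (hs : ∀ i, s i + q ≤ p) (F : CubeCell n q d) : CubeCell n p d :=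
  mk (F.base + s) F.dirs
    (fun i => by
      have h1 := hs i
      have h2 := F.base_le i
      simp only [Pi.add_apply]
      omega)
    F.card_dirs
    (fun i hi => by
      have h1 := hs i
      have h2 := F.base_lt hi
      simp only [Pi.add_apply]
      omega)

theorem facet_translate (hs : ∀ i, s i + q ≤ p) (F : CubeCell n q (d + 1)) {i : Fin n}
    (hi : i ∈ F.dirs) {ε : ℕ} (hε : ε ≤ 1) :
    (F.translate hs).facet i hi ε hε = (F.facet i hi ε hε).translate hs :=
  ext' (add_right_comm _ _ _) rfl

/-- Both sums reduce to facets, and a facet of a translate is the translate of a facet; the other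
cells of the large cube have incidence number zero. -/
theorem sum_sign_translate_smul {M : Type*} [AddCommGroup M] (hs : ∀ i, s i + q ≤ p)
    (F : CubeCell n q (d + 1)) (h : CubeCell n p d → M) :
    ∑ G, (F.translate hs).sign G • h G = ∑ G, F.sign G • h (G.translate hs) := by
  rw [sum_sign_smul, sum_sign_smul F fun G => h (G.translate hs)]
  exact Finset.sum_congr rfl fun i _ => by rw [← facet_translate, ← facet_translate]; rfl

/-- The translation by `s` as a map `[0, q]^n → [0, p]^n`. -/
def translateMap (hs : ∀ i, s i + q ≤ p) :
    C(Icc (0 : Fin n → ℝ) (fun _ => (q : ℝ)), Icc (0 : Fin n → ℝ) (fun _ => (p : ℝ))) where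
  toFun z := ⟨fun i => z.1 i + s i, fun i => add_nonneg (z.2.1 i) (Nat.cast_nonneg _), fun i => by
    have h : (s i : ℝ) + q ≤ p := by exact_mod_cast hs i
    have := z.2.2 i
    dsimp only at this ⊢
    linarith⟩
  continuous_toFun := Continuous.subtype_mk (continuous_pi fun i =>
    ((continuous_apply i).comp continuous_subtype_val).add continuous_const) _

theorem translateMap_image (hs : ∀ i, s i + q ≤ p) (F : CubeCell n q d) :
    (fun z => (translateMap hs z : Fin n → ℝ)) '' (Subtype.val ⁻¹' Icc F.lo F.hi) =
      Icc (F.translate hs).lo (F.translate hs).hi := by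
  have hsub : Icc F.lo F.hi ⊆ Icc (0 : Fin n → ℝ) (fun _ => (q : ℝ)) := by
    rw [← iUnion_closedBall, ← charFun_image_closedBall]
    exact subset_iUnion₂_of_subset d F Subset.rfl
  have hlo : ∀ i, (F.translate hs).lo i = F.lo i + s i := fun i => by simp [lo, translate]
  have hhi : ∀ i, (F.translate hs).hi i = F.hi i + s i := fun i => by
    change ((F.base i + s i : ℕ) : ℝ) + (if i ∈ F.dirs then 1 else 0) =
      F.base i + (if i ∈ F.dirs then 1 else 0) + s i
    rw [Nat.cast_add, add_right_comm]
  ext z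
  constructor
  · rintro ⟨y, hy, rfl⟩
    refine ⟨fun i => ?_, fun i => ?_⟩
    · rw [hlo]
      exact add_le_add_left (hy.1 i) _
    · rw [hhi]
      exact add_le_add_left (hy.2 i) _
  · rintro ⟨h1, h2⟩
    have hy : (fun i => z i - s i) ∈ Icc F.lo F.hi := by
      refine ⟨fun i => ?_, fun i => ?_⟩
      · have := h1 i
        rw [hlo] at this
        dsimp only
        linarith
      · have := h2 i
        rw [hhi] at this
        dsimp only
        linarith
    exact ⟨⟨_, hsub hy⟩, hy, funext fun i => sub_add_cancel _ _⟩

end CubeCell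

section

variable (k : Type*) [Field k] {n q p : ℕ} {s : Fin n → ℕ} (P : Fin n × Fin 2 ≃ Fin (2 * n))

/-- The factor `∏ y_i ^ (p - s_i - q) * z_i ^ s_i` is the same for all cells; it becomes the degree
`0` component of the morphism. -/
theorem cellLabel_translate {d : ℕ} (hs : ∀ i, s i + q ≤ p) (F : CubeCell n q d) :
    (subdividedCube P p).cellLabel (d := d) (F.translate hs) =
      (subdividedCube P q).cellLabel (d := d) F + pairExponent P (fun i => p - (s i + q)) s := by
  rw [cellLabel_subdividedCube, cellLabel_subdividedCube, pairExponent_add]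
  congr 1
  · funext i
    have h1 := hs i
    have h2 := F.base_le i
    simp only [CubeCell.translate, CubeCell.base_mk, Pi.add_apply]
    omega
  · exact funext fun i => add_right_comm _ _ _

/-- The chain map of a translation of subdivided cubes. -/
noncomputable def translateChain (hs : ∀ i, s i + q ≤ p) : ∀ i,
    (subdividedCube P q).Mod k i →ₗ[MvPolynomial (Fin (2 * n)) k] (subdividedCube P p).Mod k i
  | 0 => Finsupp.linearCombination _ fun _ => Finsupp.single (subdividedCube P p).emptyFace
      (MvPolynomial.monomial (pairExponent P (fun i => p - (s i + q)) s) 1)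
  | d + 1 => Finsupp.linearCombination _ fun F : CubeCell n q d =>
      Finsupp.single ((subdividedCube P p).toFace (d := d) (F.translate hs)) 1

theorem translateChain_zero_single (hs : ∀ i, s i + q ≤ p) (f : MvPolynomial (Fin (2 * n)) k) :
    translateChain k P hs 0 (Finsupp.single (subdividedCube P q).emptyFace f) =
      Finsupp.single (subdividedCube P p).emptyFace
        (f * MvPolynomial.monomial (pairExponent P (fun i => p - (s i + q)) s) 1) := by
  refine (Finsupp.linearCombination_single _ _ _).trans ?_
  rw [Finsupp.smul_single, smul_eq_mul]

theorem translateChain_succ_single (hs : ∀ i, s i + q ≤ p) {d : ℕ} (F : CubeCell n q d)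
    (f : MvPolynomial (Fin (2 * n)) k) :
    translateChain k P hs (d + 1)
      (Finsupp.single ((subdividedCube P q).toFace (d := d) F) f) =
      Finsupp.single ((subdividedCube P p).toFace (d := d) (F.translate hs)) f := by
  refine (Finsupp.linearCombination_single _ _ _).trans ?_
  rw [Finsupp.smul_single, smul_eq_mul, mul_one]
  rfl

theorem diff_zero_single (v : CubeCell n p 0) :
    (subdividedCube P p).diff k 0 (Finsupp.single ((subdividedCube P p).toFace (d := 0) v) 1) =
      Finsupp.single (subdividedCube P p).emptyFace
        (MvPolynomial.monomial ((subdividedCube P p).cellLabel (d := 0) v) 1) := by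
  have hsum : ∀ f : (subdividedCube P p).Face 0 → (subdividedCube P p).Mod k 0,
      ∑ G, f G = f (subdividedCube P p).emptyFace := fun f =>
    Fintype.sum_eq_single _ fun G hG => absurd rfl hG
  rw [LabelledCellComplex.diff, Finsupp.linearCombination_single, one_smul, hsum]
  change Finsupp.single _ (MvPolynomial.monomial
    ((subdividedCube P p).cellLabel (d := 0) v - 0) ((1 : ℤ) : k)) = _
  rw [tsub_zero, Int.cast_one]

theorem diff_succ_single {d : ℕ} (F : CubeCell n p (d + 1)) :
    (subdividedCube P p).diff k (d + 1)
        (Finsupp.single ((subdividedCube P p).toFace (d := d + 1) F) 1) =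
      ∑ G : CubeCell n p d, F.sign G •
        (Finsupp.single ((subdividedCube P p).toFace (d := d) G) (MvPolynomial.monomial
          ((subdividedCube P p).cellLabel (d := d + 1) F -
            (subdividedCube P p).cellLabel (d := d) G) 1) : (subdividedCube P p).Mod k (d + 1)) := by
  rw [LabelledCellComplex.diff, Finsupp.linearCombination_single, one_smul]
  refine Finset.sum_congr rfl fun G _ => ?_
  rw [← Int.cast_smul_eq_zsmul (MvPolynomial (Fin (2 * n)) k), Finsupp.smul_single, smul_eq_mul,
    ← map_intCast (MvPolynomial.C (R := k)), MvPolynomial.C_mul_monomial, mul_one]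
  rfl

/-- In positive degrees the common factor cancels in the quotients of labels. The empty face keeps
the label `1`, so in degree `0` the factor has to appear in the chain map itself. -/
theorem translateChain_diff (hs : ∀ i, s i + q ≤ p) (i : ℕ)
    (v : (subdividedCube P q).Mod k (i + 1)) :
    translateChain k P hs i ((subdividedCube P q).diff k i v) =
      (subdividedCube P p).diff k i (translateChain k P hs (i + 1) v) := by
  have h0 : ∀ F : CubeCell n q i, translateChain k P hs i ((subdividedCube P q).diff k i
      (Finsupp.single ((subdividedCube P q).toFace (d := i) F) 1)) =
      (subdividedCube P p).diff k i
        (Finsupp.single ((subdividedCube P p).toFace (d := i) (F.translate hs)) 1) := by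
    intro F
    cases i with
    | zero =>
      rw [diff_zero_single, translateChain_zero_single, diff_zero_single, cellLabel_translate,
        MvPolynomial.monomial_mul, one_mul]
    | succ d =>
      rw [diff_succ_single, diff_succ_single, CubeCell.sum_sign_translate_smul, map_sum]
      refine Finset.sum_congr rfl fun G _ => ?_
      rw [map_zsmul, translateChain_succ_single, cellLabel_translate, cellLabel_translate,
        add_tsub_add_eq_tsub_right]
  suffices h : (translateChain k P hs i).comp ((subdividedCube P q).diff k i) =
      ((subdividedCube P p).diff k i).comp (translateChain k P hs (i + 1)) from
    LinearMap.congr_fun h v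
  refine Finsupp.lhom_ext' fun F => LinearMap.ext_ring ((h0 F).trans ?_)
  exact congrArg ((subdividedCube P p).diff k i) (translateChain_succ_single k P hs F 1).symm

/-- A translation of subdivided cubes as a morphism of cellular complexes. -/
noncomputable def translateMorphism (hs : ∀ i, s i + q ≤ p) :
    LabelledCellComplex.CellMorphism (subdividedCube P q) (subdividedCube P p) k where
  chain := translateChain k P hs
  map := CubeCell.translateMap hs
  comm := translateChain_diff k P hs
  compatible d := fun F : CubeCell n q d => by
    refine ⟨CubeCell.translate hs F, ?_, ?_, 1, one_ne_zero, translateChain_succ_single k P hs F 1⟩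
    · have h := CubeCell.translateMap_image hs F
      rw [← closedCell_subdividedCube P, ← closedCell_subdividedCube P] at h
      exact h
    · rw [translateChain_zero_single, cellLabel_translate, MvPolynomial.monomial_mul, one_mul]

/-! ### Covering by unit cubes and generators of the syzygies -/

namespace CubeFamily

variable {k P}

/-- A translation as a morphism of the family of the subdivided cubes. -/
noncomputable def translation {A B : CubeFamily k P} (hs : ∀ i, s i + A.p ≤ B.p) : Hom A B :=
  ⟨translateMorphism k P hs,
    ⟨pairExponent P (fun i => B.p - (s i + A.p)) s,
      (translateChain_zero_single k P hs 1).trans (by rw [one_mul])⟩,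
    fun i => s i, fun _ => rfl⟩

theorem covers_of_one_le (B : CubeFamily k P) : Covers (⟨1, le_rfl⟩ : CubeFamily k P) B := by
  have hB := B.one_le
  refine ⟨⟨translation (s := 0) fun _ => by simpa using hB⟩, eq_univ_of_forall fun z => ?_⟩
  obtain ⟨z, hz⟩ := z
  change z ∈ Icc (0 : Fin n → ℝ) (fun _ => (B.p : ℝ)) at hz
  -- The corner of a unit cube containing `z`. The cap `B.p - 1` matters only for `z i = B.p`, where
  -- the floor would leave the large cube.
  have hs : ∀ i, min ⌊z i⌋₊ (B.p - 1) + 1 ≤ B.p := fun i => by omega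
  refine mem_iUnion.2 ⟨translation hs, ⟨fun i => z i - (min ⌊z i⌋₊ (B.p - 1) : ℕ),
    fun i => ?_, fun i => ?_⟩, ?_⟩
  · have h1 : ((min ⌊z i⌋₊ (B.p - 1) : ℕ) : ℝ) ≤ ⌊z i⌋₊ := by exact_mod_cast min_le_left _ _
    exact sub_nonneg.2 (h1.trans (Nat.floor_le (hz.1 i)))
  · change z i - (min ⌊z i⌋₊ (B.p - 1) : ℕ) ≤ ((1 : ℕ) : ℝ)
    rcases min_choice ⌊z i⌋₊ (B.p - 1) with h | h
    · rw [h, Nat.cast_one]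
      linarith [Nat.lt_floor_add_one (z i)]
    · have h2 : z i ≤ B.p := hz.2 i
      rw [h, Nat.cast_sub hB, Nat.cast_one]
      linarith
  · exact Subtype.ext (funext fun i => sub_add_cancel _ _)

/-- The lower corner is capped at `p - 1` as for points: where it equals `p`, the cell does not
extend in that direction and lies on the upper side of the unit cube. -/
theorem _root_.CubeCell.exists_translate_eq {d : ℕ} (hp : 1 ≤ p) (F : CubeCell n p d) :
    ∃ (s : Fin n → ℕ) (hs : ∀ i, s i + 1 ≤ p) (G : CubeCell n 1 d), G.translate hs = F := by
  refine ⟨fun i => min (F.base i) (p - 1), fun i => by dsimp only; omega,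
    CubeCell.mk (fun i => F.base i - min (F.base i) (p - 1)) F.dirs (fun i => ?_) F.card_dirs
      (fun i hi => ?_), CubeCell.ext' (funext fun i => ?_) rfl⟩
  · have := F.base_le i
    omega
  · have := F.base_lt hi
    omega
  · exact Nat.sub_add_cancel (min_le_left _ _)

theorem isFinitelyGenerated_syzygyRep (t : ℕ) : IsFinitelyGeneratedRep (syzygyRep k P t) := by
  let A : CubeFamily k P := ⟨1, le_rfl⟩
  -- The generators are the boundaries of the cells of the single unit cube `C_n^1`.
  let T : A.cube.Face (t + 1) → Σ x : CubeFamily k P, (syzygyRep k P t).obj x := fun F =>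
    ⟨A, (A.cube.diff k t).rangeRestrict (Finsupp.single F 1)⟩
  refine ⟨range T, finite_range T, fun N hN B => ?_⟩
  have hB : ∀ u : B.cube.Mod k (t + 1), (B.cube.diff k t).rangeRestrict u ∈ N.obj B := by
    intro u
    induction u using Finsupp.induction_linear with
    | zero =>
      rw [map_zero]
      exact zero_mem _
    | add u v hu hv =>
      rw [map_add]
      exact add_mem hu hv
    | single F f =>
      obtain ⟨s, hs, G, rfl⟩ := CubeCell.exists_translate_eq B.one_le F
      have h := N.map_mem (x := A) (y := B) (translation hs) _ (hN (T G) (mem_range_self G))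
      -- The translation sends the boundary of `G` to the boundary of its translate, with
      -- coefficient `1`, since the chain map has coefficient `1` on cells.
      have h' : ((syzygyRep k P t).map (X := A) (Y := B) (translation hs)).hom (T G).2 =
          (B.cube.diff k t).rangeRestrict
            (Finsupp.single (B.cube.toFace (d := t) (G.translate hs)) 1) := by
        refine Subtype.ext ((translateChain_diff k P hs t _).trans ?_)
        exact congrArg (B.cube.diff k t) (translateChain_succ_single k P hs G 1)
      have h1 : (Finsupp.single (G.translate hs) f : B.cube.Mod k (t + 1)) =
          f • Finsupp.single (B.cube.toFace (d := t) (G.translate hs)) 1 := by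
        rw [Finsupp.smul_single, smul_eq_mul, mul_one]
        rfl
      rw [h'] at h
      rw [h1, map_smul]
      exact Submodule.smul_mem _ f h
  refine eq_top_iff.2 ?_
  rintro ⟨_, u, rfl⟩ -
  exact hB u

end CubeFamily

end

/-! ### The powers of the cube ideal -/

section

open scoped Pointwise

variable (k : Type*) [Field k] {n : ℕ} (P : Fin n × Fin 2 ≃ Fin (2 * n))

theorem prod_pairs_eq_monomial {p : ℕ} (e : Fin p → Fin n → Fin 2) {a : Fin n → ℕ}
    (ha : ∀ i, (Finset.univ.filter fun j => e j i = 1).card = a i) :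
    (∏ j, ∏ i, MvPolynomial.X (P (i, e j i)) : MvPolynomial (Fin (2 * n)) k) =
      MvPolynomial.monomial (pairExponent P (fun i => p - a i) a) 1 := by
  rw [monomial_pairExponent, Finset.prod_comm]
  refine Finset.prod_congr rfl fun i _ => ?_
  have hX : ∀ j, (MvPolynomial.X (P (i, e j i)) : MvPolynomial (Fin (2 * n)) k) =
      if e j i = 1 then MvPolynomial.X (P (i, 1)) else MvPolynomial.X (P (i, 0)) := by
    intro j
    split_ifs with h
    · rw [h]
    · rw [show e j i = 0 by omega]
  have hcard := Finset.card_filter_add_card_filter_not (s := Finset.univ) fun j => e j i = 1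
  rw [ha, Finset.card_univ, Fintype.card_fin] at hcard
  rw [Finset.prod_congr rfl fun j _ => hX j, Finset.prod_ite, Finset.prod_const, Finset.prod_const,
    ha, show (Finset.univ.filter fun j => ¬ e j i = 1).card = p - a i by omega]
  exact mul_comm _ _

/-- In a product of `p` generators let `a_i` count the factors that use `z_i`; the product is the
label of the vertex `a`, and every `a` in `{0, …, p}^n` occurs. -/
theorem cubeIdeal_pow (p : ℕ) :
    cubeIdeal k P ^ p = Ideal.span (range fun v : CubeCell n p 0 =>
      MvPolynomial.monomial (pairExponent P (fun i => p - v.base i) v.base) (1 : k)) := by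
  have h : cubeIdeal k P ^ p = Ideal.span (∏ _j : Fin p,
      range fun e : Fin n → Fin 2 =>
        (∏ i, MvPolynomial.X (P (i, e i)) : MvPolynomial (Fin (2 * n)) k)) := by
    rw [← Ideal.prod_span, Finset.prod_const, Finset.card_univ, Fintype.card_fin]
    rfl
  rw [h]
  congr 1
  ext f
  simp only [Set.mem_fintype_prod, mem_range, exists_prop]
  constructor
  · rintro ⟨g, hg, rfl⟩
    choose e he using fun j => hg j
    refine ⟨CubeCell.mk (fun i => (Finset.univ.filter fun j => e j i = 1).card) ∅
      (fun i => (Finset.card_le_univ _).trans_eq (Fintype.card_fin p)) Finset.card_empty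
      (by simp), ?_⟩
    rw [← Finset.prod_congr rfl fun j _ => he j]
    exact (prod_pairs_eq_monomial k P e fun i => rfl).symm
  · rintro ⟨v, rfl⟩
    -- To realize a vertex `a`, the factor number `j` takes `z_i` exactly when `j < a_i`, so `z_i`
    -- is taken `a_i` times in each direction independently.
    refine ⟨_, fun j => ⟨fun i => if (j : ℕ) < v.base i then 1 else 0, rfl⟩, ?_⟩
    refine prod_pairs_eq_monomial k P
      (fun (j : Fin p) i => if (j : ℕ) < v.base i then 1 else 0) fun i => ?_
    have := v.base_le i
    simp [Fin.card_filter_val_lt, this]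

theorem map_range_diff_zero (p : ℕ) :
    (LinearMap.range ((subdividedCube P p).diff k 0)).map
      (Finsupp.lapply (R := MvPolynomial (Fin (2 * n)) k) (M := MvPolynomial (Fin (2 * n)) k)
        (subdividedCube P p).emptyFace) = cubeIdeal k P ^ p := by
  classical
  rw [cubeIdeal_pow, LabelledCellComplex.diff, Finsupp.range_linearCombination, Submodule.map_span,
    ← range_comp]
  refine congrArg (Submodule.span _) (congrArg range (funext fun v : CubeCell n p 0 => ?_))
  have hv : v.dirs = ∅ := Finset.card_eq_zero.1 v.card_dirs
  have hlabel := cellLabel_subdividedCube P v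
  simp only [hv, Finset.notMem_empty, if_false, add_zero] at hlabel
  have h := diff_zero_single k P v
  rw [LabelledCellComplex.diff, Finsupp.linearCombination_single, one_smul, hlabel] at h
  exact (congrArg (Finsupp.lapply (R := MvPolynomial (Fin (2 * n)) k)
    (M := MvPolynomial (Fin (2 * n)) k) (subdividedCube P p).emptyFace) h).trans
      Finsupp.single_eq_same

theorem supportsResolution_subdividedCube (p : ℕ) :
    (subdividedCube P p).SupportsResolution k (cubeIdeal k P ^ p) :=
  ⟨exact_diff_subdividedCube k P p, map_range_diff_zero k P p⟩

end

theorem mainTheorem7 {k : Type*} [Field k] {n : ℕ} (P : Fin n × Fin 2 ≃ Fin (2 * n)) :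
    (∀ p : ℕ, 1 ≤ p → (subdividedCube P p).SupportsResolution k (cubeIdeal k P ^ p)) ∧
    (∀ (p : ℕ) (hp : 2 ≤ p),
      CubeFamily.Covers (⟨1, le_rfl⟩ : CubeFamily k P) ⟨p, le_trans one_le_two hp⟩) ∧
    ∀ t : ℕ, IsFinitelyGeneratedRep (CubeFamily.syzygyRep k P t) :=
  ⟨fun p _ => supportsResolution_subdividedCube k P p,
    fun p hp => CubeFamily.covers_of_one_le ⟨p, le_trans one_le_two hp⟩,
    CubeFamily.isFinitelyGenerated_syzygyRep⟩
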